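/- Let $k\ge 2$ and let $M_K=\langle Q,\Gamma,\bar b,\Sigma,q_0,F,\delta^{(k)}\rangle$ be a $k$-tape Turing machine whose tapes have the finite input/output alphabets $\Sigma_1,\dots,\Sigma_k$; tape $1$ carries symbols of $\Sigma_1\cup\{\bar b\}$ and tape $i\ge 2$ carries symbols of $\Sigma_i\cup\{\bar b,Z_0\}$. The transition function is partial and undefined on final states; in the starting configuration tape $1$ contains the input with the head on its first character, and every other tape contains just the symbol $Z_0$ with the head on it. Consider a single tape divided into $2k$ tracks: $k$ tracks for the characters of the $k$ tapes, and $k$ tracks for markers that show the positions of the $k$ heads. Its alphabet $\Gamma'$ has $$|\Gamma'|=2^k\,(|\Sigma_1|+1)\prod_{i=2}^{k}(|\Sigma_i|+2)$$ symbols. A configuration of a single-tape machine with this tape *represents* a configuration of $M_K$ if its state shows the state of $M_K$ (by a fixed map $\pi:Q'\to Q$), both configurations are final or neither is, and for every $i$ the $i$-th character track together with the $i$-th marker track shows the content of tape $i$ together with its head position, up to a translation. Then there are a single-tape Turing machine $M'=\langle Q',\Gamma',\bar b,\Sigma',q_0',F',\delta'\rangle$ with tape alphabet $\Gamma'$ and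 a map $\pi:Q'\to Q$, depending only on $M_K$, such that the following holds when $M'$ is started on the $2k$-track form of the starting configuration of $M_K$. 1. $M'$ is equivalent to $M_K$: on every input, whenever $M_K$ reaches a final configuration, so does $M'$, and the final configuration of $M'$ represents that of $M_K$; and every final configuration reached by $M'$ represents a final configuration reached by $M_K$. 2. Let ① (grossone) be any hypernatural number that is larger than every finite natural number and divisible by every finite positive natural number (hypernaturals being taken in the ultrapower that defines the hyperreals, and computations being extended to hyperfinite inputs and numbers of steps). If $M_K$ performs $t$ computational steps on an input $x$ ($t$ and the length of $x$ finite or infinite) and $$t\le \tfrac12\left(\sqrt{4\,①+1}-1\right),$$ then there is $s\le t^2+t\le ①$ such that $M'$ on $x$, after $s$ steps, represents a configuration that $M_K$ reaches after some number $t'\ge t$ of steps; if $M_K$ is in a final configuration after $t$ steps, then $t'=t$ and $M'$ is in a final configuration after $s$ steps. In particular this simulation has at most ① steps, that is, it can be observed in a sequence. -/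

import Mathlib

namespace GrossoneTM

open Filter

/-! ### Internal (hyperfinite) objects and grossone -/

/-- The ultrapower `*α` along the ultrafilter of Mathlib's hyperreals. Its elements are the
internal objects of kind `α`: `Internal ℕ` are the hypernaturals, `Internal (List σ)` the words of finite
or hyperfinite length, and so on. -/
abbrev Internal (α : Type) : Type := Germ (hyperfilter ℕ : Filter ℕ) α

/-- A hypernatural seen as a hyperreal. -/
noncomputable def toHyperreal (n : Internal ℕ) : Hyperreal := Germ.map (fun m : ℕ => (m : ℝ)) n

/-- The square root on the hyperreals. -/
noncomputable def hsqrt (x : Hyperreal) : Hyperreal := Germ.map Real.sqrt x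

/-- The postulates of grossone: it is a (hyper)natural number larger than every finite natural
number (infinity), and it is divisible by every finite positive natural number (divisibility).
The identities `0 * G = 0`, `G - G = 0`, `G / G = 1`, `G ^ 0 = 1`, ... hold for every
(nonzero) hypernatural in the ordered field of hyperreals. -/
structure IsGrossone (G : Internal ℕ) : Prop where
  infinite : ∀ n : ℕ, (n : Internal ℕ) < G
  divisible : ∀ n : ℕ, 0 < n → (n : Internal ℕ) ∣ G

/-- A process of `s` steps can be observed in a sequence: no sequence has more than grossone
elements. -/
def ObservableInSequence (G s : Internal ℕ) : Prop := s ≤ G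

/-! ### Moves and tape symbols -/

/-- Head moves: left, right, no move. -/
inductive Move
  | L
  | R
  | N

/-- Displacement of the head. -/
def Move.shift : Move → ℤ
  | .L => -1
  | .R => 1
  | .N => 0

variable {k : ℕ} [NeZero k]

/-- The symbols `Γᵢ` that may occur on tape `i`: the blank, the letters of `Σᵢ` and, on every tape
but the first one, the starting symbol `Z₀`. -/
inductive TapeSym (Sig : Fin k → Type) (i : Fin k) : Type
  | blank : TapeSym Sig i
  | start (h : i ≠ 0) : TapeSym Sig i
  | letter (a : Sig i) : TapeSym Sig i

/-! ### Multi-tape machines -/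

/-- A `k`-tape Turing machine with input/output alphabets `Σ₁, …, Σₖ`, given by its finite set of
states, initial state, set of final states, and partial transition function, which is not defined
on final states. -/
structure MultiTM (Sig : Fin k → Type) where
  Q : Type
  finite_Q : Finite Q
  q₀ : Q
  F : Set Q
  δ : Q → (∀ i, TapeSym Sig i) → Option (Q × (∀ i, TapeSym Sig i) × (Fin k → Move))
  δ_final : ∀ q ∈ F, ∀ a, δ q a = none

/-- The tapes in the starting configuration: the word `x` on the first tape (beginning at cell
`0`), the symbol `Z₀` in cell `0` of the other tapes, and blanks everywhere else. -/
def startTape (Sig : Fin k → Type) (x : List (Sig 0)) (i : Fin k) (z : ℤ) : TapeSym Sig i :=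
  if h : i = 0 then
    if 0 ≤ z then
      match x[z.toNat]? with
      | some a => .letter (cast (congrArg Sig h.symm) a)
      | none => .blank
    else .blank
  else if z = 0 then .start h else .blank

namespace MultiTM

variable {Sig : Fin k → Type} (M : MultiTM Sig)

/-- A configuration: the state, the contents of the tapes and the positions of the heads. -/
structure Config where
  state : M.Q
  tape : (i : Fin k) → ℤ → TapeSym Sig i
  head : Fin k → ℤ

/-- The starting configuration on the input word `x`; all heads are on cell `0`. -/
def start (x : List (Sig 0)) : M.Config := ⟨M.q₀, startTape Sig x, fun _ => 0⟩

/-- One computational step: one application of the transition function, if it is defined. -/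
def step (c : M.Config) : Option M.Config :=
  (M.δ c.state (fun i => c.tape i (c.head i))).map fun r =>
    { state := r.1
      tape := fun i => Function.update (c.tape i) (c.head i) (r.2.1 i)
      head := fun i => c.head i + (r.2.2 i).shift }

/-- The configuration reached on the input `x` after exactly `n` computational steps, if the
machine performs that many steps. -/
def run (x : List (Sig 0)) : ℕ → Option M.Config
  | 0 => some (M.start x)
  | n + 1 => (run x n).bind M.step

/-- A final configuration. -/
def Config.Final {M : MultiTM Sig} (c : M.Config) : Prop := c.state ∈ M.F

/-- The extension of `run` to internal inputs and numbers of steps: on the (possibly hyperfinite)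
word `x` the machine performs `n` steps and then is in the internal configuration `c`. -/
def Reaches (x : Internal (List (Sig 0))) (n : Internal ℕ) (c : Internal M.Config) : Prop :=
  Germ.map₂ M.run x n = Germ.map some c

end MultiTM

/-! ### Single-tape machines -/

/-- A single-tape Turing machine with tape alphabet `Γ` and blank symbol `b`. -/
structure SingleTM (Γ : Type) (b : Γ) where
  Q : Type
  finite_Q : Finite Q
  /-- The input/output symbols. -/
  Sig : Set Γ
  blank_notMem : b ∉ Sig
  q₀ : Q
  F : Set Q
  δ : Q → Γ → Option (Q × Γ × Move)
  δ_final : ∀ q ∈ F, ∀ a, δ q a = none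

namespace SingleTM

variable {Γ : Type} {b : Γ} (M : SingleTM Γ b)

/-- A configuration: the state, the content of the tape and the position of the head. -/
structure Config where
  state : M.Q
  tape : ℤ → Γ
  head : ℤ

/-- The starting configuration on a given initial tape; the head is on cell `0`. -/
def start (T : ℤ → Γ) : M.Config := ⟨M.q₀, T, 0⟩

/-- One computational step: one application of the transition function, if it is defined. -/
def step (c : M.Config) : Option M.Config :=
  (M.δ c.state (c.tape c.head)).map fun r =>
    { state := r.1
      tape := Function.update c.tape c.head r.2.1
      head := c.head + r.2.2.shift }

/-- The configuration reached from the initial tape `T` after exactly `n` steps, if the machine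
performs that many steps. -/
def run (T : ℤ → Γ) : ℕ → Option M.Config
  | 0 => some (M.start T)
  | n + 1 => (run T n).bind M.step

/-- A final configuration. -/
def Config.Final {M : SingleTM Γ b} (c : M.Config) : Prop := c.state ∈ M.F

end SingleTM

/-! ### The `2k`-track tape and simulation -/

/-- The alphabet of a tape with `2k` tracks: `k` tracks with the characters of the `k` tapes, and
`k` tracks each cell of which is either marked or not. -/
abbrev Track (Sig : Fin k → Type) : Type := (∀ i, TapeSym Sig i) × (Fin k → Bool)

/-- The blank of the `2k`-track tape: blank on all tracks. -/
def trackBlank (Sig : Fin k → Type) : Track Sig := (fun _ => .blank, fun _ => false)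

variable {Sig : Fin k → Type}

/-- The `2k`-track tape of the starting configuration on `x`: the tapes on the first `k` tracks,
and on the other `k` tracks a marker at the position of each head, that is, at cell `0`. -/
def trackStart (Sig : Fin k → Type) (x : List (Sig 0)) (z : ℤ) : Track Sig :=
  (fun i => startTape Sig x i z, fun _ => decide (z = 0))

/-- The configuration `c'` of the single-tape machine represents the configuration `c` of the
multi-tape machine, where the simulated state is read off by `π`. A configuration of a multi-tape
machine is given by its state and, for each tape, by the word on the tape and the place of the head
in this word, `αᵢ↑βᵢ`; cells have no absolute address. So for every `i` the two `i`-th tracks have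
to show tape `i` and its head, up to a translation. -/
def Represents {M : MultiTM Sig} {M' : SingleTM (Track Sig) (trackBlank Sig)}
    (π : M'.Q → M.Q) (c' : M'.Config) (c : M.Config) : Prop :=
  π c'.state = c.state ∧ (c'.Final ↔ c.Final) ∧
    ∀ i, ∃ d : ℤ, ∀ z,
      (c'.tape (z + d)).1 i = c.tape i z ∧ (c'.tape (z + d)).2 i = decide (z = c.head i)

/-- The single-tape machine is equivalent to the multi-tape machine: on every input it reaches a
final configuration if and only if the multi-tape machine does, and the final configuration
represents that of the multi-tape machine. -/
def Equivalent (M : MultiTM Sig) (M' : SingleTM (Track Sig) (trackBlank Sig))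
    (π : M'.Q → M.Q) : Prop :=
  ∀ x : List (Sig 0),
    (∀ t c, M.run x t = some c → c.Final →
      ∃ s c', M'.run (trackStart Sig x) s = some c' ∧ c'.Final ∧ Represents π c' c) ∧
    (∀ s c', M'.run (trackStart Sig x) s = some c' → c'.Final →
      ∃ t c, M.run x t = some c ∧ c.Final ∧ Represents π c' c)

/-- `SingleTM.run` on the `2k`-track representation of an input, extended to internal inputs and
numbers of steps. -/
def SingleTM.Reaches (M' : SingleTM (Track Sig) (trackBlank Sig))
    (x : Internal (List (Sig 0))) (n : Internal ℕ) (c' : Internal M'.Config) : Prop :=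
  Germ.map₂ (fun w => M'.run (trackStart Sig w)) x n = Germ.map some c'

/-- On the (possibly hyperfinite) input `x`, the single-tape machine simulates at least the first
`t` steps of the multi-tape machine within its first `s` steps: after `s` steps it represents a
configuration `d` that the multi-tape machine reaches after some number `t' ≥ t` of steps. If the
multi-tape machine is in a final configuration after `t` steps, then the configuration that is
represented is this one, and the single-tape machine is in a final configuration too. -/
def Simulates (M : MultiTM Sig) (M' : SingleTM (Track Sig) (trackBlank Sig)) (π : M'.Q → M.Q)
    (x : Internal (List (Sig 0))) (t : Internal ℕ) (s : Internal ℕ) : Prop :=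
  ∃ (t' : Internal ℕ) (d : Internal M.Config) (c' : Internal M'.Config),
    t ≤ t' ∧ M.Reaches x t' d ∧ M'.Reaches x s c' ∧
      Germ.LiftRel (Represents π) c' d ∧
      ∀ c : Internal M.Config, M.Reaches x t c → Germ.LiftPred (fun e => e.Final) c →
        t' = t ∧ d = c ∧ Germ.LiftPred (fun e => e.Final) c'

end GrossoneTM

/-! Since `t ^ 2 + t` is the sum of `2 * j` over `1 ≤ j ≤ t`, it suffices to simulate step `j` of
the multi-tape machine in at most `2 * j` steps. Two regimes achieve this.

Sweeping. The finite control holds the simulated state and all scanned symbols, so a single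
traversal of the heads, in alternating directions, simulates a step: it rewrites the marked cells,
moves the markers and collects the symbols under the new heads. Only heads that move against the
sweep need a detour, of two steps. If the heads lie within `w + 1` cells, a sweep costs at most `w +
2 * k + 2`, and `w` grows by at most 2 (`Sweeper.steps_ready`). With `w = 2 * k` at time `2 * k`
this gives `w = 2 * t - 2 * k`, and step `t + 1` costs at most `2 * (t + 1)`.

Memory. The detours are too expensive during the first `2 * k` steps. There the states store a
configuration, and the tape is rewritten on a window of `n + 1` cells after `n` steps. Tapes other
than the first are blank outside the window and may be translated, so that only the first head
decides at which end the window gains its one new cell (`Recorder.ReadyAt.steps`). This phase has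
bounded length, hence only finitely many of its states are reachable (`Recorder.finite_reachable`).

`exists_showsAt` adds up the costs. Each simulated step costs at least one step, and the simulation
gets stuck exactly where it shows a stuck configuration; this yields equivalence. Hyperfinite
computations are treated coordinatewise in the ultrapower, where the hypothesis on `t` becomes `t ^
2 + t ≤ G` by squaring. -/

namespace GrossoneTM

variable {k : ℕ} [NeZero k] {Sig : Fin k → Type}

/-! ### Finiteness of the alphabets -/

/-- The code of a tape symbol on the first tape. -/
def tapeSymEquivZero : TapeSym Sig 0 ≃ Option (Sig 0) where
  toFun
    | .blank => none
    | .start h => absurd rfl h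
    | .letter a => some a
  invFun
    | none => .blank
    | some a => .letter a
  left_inv := by
    rintro (_ | h | _)
    · rfl
    · exact absurd rfl h
    · rfl
  right_inv := by rintro (_ | _) <;> rfl

/-- The code of a tape symbol on another tape. -/
def tapeSymEquivOfNe {i : Fin k} (hi : i ≠ 0) : TapeSym Sig i ≃ Option (Option (Sig i)) where
  toFun
    | .blank => none
    | .start _ => some none
    | .letter a => some (some a)
  invFun
    | none => .blank
    | some none => .start hi
    | some (some a) => .letter a
  left_inv := by rintro (_ | _ | _) <;> rfl
  right_inv := by rintro (_ | _ | _) <;> rfl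

instance [∀ i, Finite (Sig i)] (i : Fin k) : Finite (TapeSym Sig i) := by
  by_cases hi : i = 0
  · subst hi
    exact Finite.of_equiv _ tapeSymEquivZero.symm
  · exact Finite.of_equiv _ (tapeSymEquivOfNe hi).symm

theorem card_track [∀ i, Finite (Sig i)] :
    Nat.card (Track Sig) =
      2 ^ k * (Nat.card (Sig 0) + 1) *
        ∏ i ∈ (Finset.univ.erase (0 : Fin k)), (Nat.card (Sig i) + 2) := by
  have h0 : Nat.card (TapeSym Sig 0) = Nat.card (Sig 0) + 1 := by
    rw [Nat.card_congr tapeSymEquivZero, Finite.card_option]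
  have h1 : ∀ i ∈ Finset.univ.erase (0 : Fin k),
      Nat.card (TapeSym Sig i) = Nat.card (Sig i) + 2 := by
    intro i hi
    rw [Nat.card_congr (tapeSymEquivOfNe (Finset.ne_of_mem_erase hi)), Finite.card_option,
      Finite.card_option]
  rw [Track, Nat.card_prod, Nat.card_pi, Nat.card_pi, ← Finset.mul_prod_erase _ _ (Finset.mem_univ 0),
    h0, Finset.prod_congr rfl h1]
  simp
  ring

instance : Finite Move :=
  Finite.of_injective
      (fun m : Move => match m with | .L => (0 : Fin 3) | .R => 1 | .N => 2)
      (fun a b h => by cases a <;> cases b <;> simp_all)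

/-! ### Directions -/

/-- The unit displacement in a direction: right for `true`, left for `false`. -/
def sgn : Bool → ℤ
  | true => 1
  | false => -1

/-- The move in a direction. -/
def dirMove : Bool → Move
  | true => .R
  | false => .L

@[simp] theorem dirMove_shift (s : Bool) : (dirMove s).shift = sgn s := by cases s <;> rfl

@[simp] theorem sgn_not (s : Bool) : sgn (!s) = -sgn s := by cases s <;> rfl

/-! ### Transition functions without a bound on the number of states -/

/-- A configuration of a single-tape machine with states in `Q`. -/
structure Conf (Q Γ : Type) where
  state : Q
  tape : ℤ → Γ
  head : ℤ

section Conf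

variable {Q Γ : Type}

/-- One step of the transition function `δ`. -/
def Conf.step (δ : Q → Γ → Option (Q × Γ × Move)) (c : Conf Q Γ) : Option (Conf Q Γ) :=
  (δ c.state (c.tape c.head)).map fun r =>
    ⟨r.1, Function.update c.tape c.head r.2.1, c.head + r.2.2.shift⟩

/-- The configuration `c'` is reached from `c` in exactly `n` steps. -/
def Conf.Steps (δ : Q → Γ → Option (Q × Γ × Move)) : ℕ → Conf Q Γ → Conf Q Γ → Prop
  | 0, c, c' => c = c'
  | n + 1, c, c' => ∃ d, c.step δ = some d ∧ Conf.Steps δ n d c'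

variable {δ : Q → Γ → Option (Q × Γ × Move)}

theorem Conf.Steps.trans {m n : ℕ} {a b c : Conf Q Γ} (h : Conf.Steps δ m a b)
    (h' : Conf.Steps δ n b c) : Conf.Steps δ (m + n) a c := by
  induction m generalizing a with
  | zero => cases h; simpa using h'
  | succ m ih =>
    obtain ⟨d, hd, h⟩ := h
    rw [Nat.succ_add]
    exact ⟨d, hd, ih h⟩

theorem Conf.step_eq {c : Conf Q Γ} {q : Q} {w : Γ} {m : Move}
    (h : δ c.state (c.tape c.head) = some (q, w, m)) :
    c.step δ = some ⟨q, Function.update c.tape c.head w, c.head + m.shift⟩ := by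
  simp [Conf.step, h]

end Conf

/-! ### Multi-tape configurations up to translation of the tapes -/

namespace MultiTM

variable {M : MultiTM Sig}

/-- The symbols under the heads. -/
def Config.scan (c : M.Config) (i : Fin k) : TapeSym Sig i := c.tape i (c.head i)

/-- The `2k`-track tape that shows the tapes of a configuration. -/
def Config.encode (c : M.Config) (z : ℤ) : Track Sig :=
  (fun i => c.tape i z, fun i => decide (z = c.head i))

/-- The configuration after the application of an instruction. -/
def Config.apply (c : M.Config) (r : M.Q × (∀ i, TapeSym Sig i) × (Fin k → Move)) : M.Config where
  state := r.1
  tape := fun i => Function.update (c.tape i) (c.head i) (r.2.1 i)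
  head := fun i => c.head i + (r.2.2 i).shift

theorem step_eq (c : M.Config) : M.step c = (M.δ c.state c.scan).map c.apply := rfl

/-- The configurations differ by translations of the tapes. -/
def Config.Shifted (c d : M.Config) : Prop :=
  d.state = c.state ∧ ∀ i, ∃ e : ℤ, d.head i = c.head i + e ∧ ∀ z, d.tape i (z + e) = c.tape i z

theorem Config.Shifted.refl (c : M.Config) : c.Shifted c :=
  ⟨rfl, fun _ => ⟨0, by simp, by simp⟩⟩

theorem Config.Shifted.trans {a b c : M.Config} (h : a.Shifted b) (h' : b.Shifted c) :
    a.Shifted c := by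
  refine ⟨h'.1.trans h.1, fun i => ?_⟩
  obtain ⟨e, he, ht⟩ := h.2 i
  obtain ⟨e', he', ht'⟩ := h'.2 i
  exact ⟨e + e', by rw [he', he, add_assoc], fun z => by rw [← add_assoc, ht', ht]⟩

theorem Config.Shifted.scan_eq {c d : M.Config} (h : c.Shifted d) : d.scan = c.scan := by
  funext i
  obtain ⟨e, he, ht⟩ := h.2 i
  rw [Config.scan, he, ht, Config.scan]

/-- An instruction acts relative to the head, so each tape keeps its own offset. Hence the
simulation may continue from a translated configuration. -/
theorem Config.Shifted.apply {c d : M.Config} (h : c.Shifted d)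
    (r : M.Q × (∀ i, TapeSym Sig i) × (Fin k → Move)) : (c.apply r).Shifted (d.apply r) := by
  refine ⟨rfl, fun i => ?_⟩
  obtain ⟨e, he, ht⟩ := h.2 i
  refine ⟨e, by simp [Config.apply, he]; ring, fun z => ?_⟩
  simp only [Config.apply, Function.update_apply, he, ht]
  simp

theorem Config.Shifted.represents {c d : M.Config} (h : c.Shifted d)
    {M' : SingleTM (Track Sig) (trackBlank Sig)} {π : M'.Q → M.Q} {c' : M'.Config}
    (hq : π c'.state = d.state) (hF : c'.Final ↔ d.Final) (ht : c'.tape = d.encode) :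
    Represents π c' c := by
  refine ⟨hq.trans h.1, ?_, fun i => ?_⟩
  · rw [hF, Config.Final, Config.Final, h.1]
  · obtain ⟨e, he, h'⟩ := h.2 i
    exact ⟨e, fun z => by simp [ht, Config.encode, he, h']⟩

end MultiTM

/-! ### Simulating one step in one sweep -/

/-- How far a sweep has come with tape `i`: the head has not been met; the symbol has been replaced
and the marker is to be put on the next cell, or on the previous cell; the step is completed, and
this is the symbol under the new head. -/
inductive Progress (Sig : Fin k → Type) (i : Fin k) : Type
  | todo : Progress Sig i
  | ahead : Progress Sig i
  | behind : Progress Sig i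
  | done (a : TapeSym Sig i) : Progress Sig i

/-- The symbol under the new head. -/
def Progress.sym {i : Fin k} : Progress Sig i → TapeSym Sig i
  | .done a => a
  | _ => .blank

instance [∀ i, Finite (Sig i)] (i : Fin k) : Finite (Progress Sig i) :=
  Finite.of_injective
    (fun p : Progress Sig i => match p with
      | .todo => (none : Option (Option (Option (TapeSym Sig i))))
      | .ahead => some none
      | .behind => some (some none)
      | .done a => some (some (some a)))
    (fun a b h => by cases a <;> cases b <;> simp_all)

/-- The states of the sweeping machine. In `ready q a s` the state `q` and the scanned symbols `a`
are known, and no marker is behind in the direction `s`. In `fwd q a mv s st` the machine sweeps in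
the direction `s`; in `bwd q a mv s st` it has stepped back to put markers there. -/
inductive Sweeper (M : MultiTM Sig) : Type
  | ready (q : M.Q) (a : ∀ i, TapeSym Sig i) (s : Bool)
  | fwd (r : M.Q × (∀ i, TapeSym Sig i) × (Fin k → Move)) (s : Bool) (st : ∀ i, Progress Sig i)
  | bwd (r : M.Q × (∀ i, TapeSym Sig i) × (Fin k → Move)) (s : Bool) (st : ∀ i, Progress Sig i)

instance [∀ i, Finite (Sig i)] (M : MultiTM Sig) : Finite (Sweeper M) := by
  have := M.finite_Q
  exact Finite.of_injective
    (fun p : Sweeper M => match p with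
      | .ready q a s => (Sum.inl (q, a, s) : (M.Q × (∀ i, TapeSym Sig i) × Bool) ⊕
          (Bool × (M.Q × (∀ i, TapeSym Sig i) × (Fin k → Move)) × Bool × (∀ i, Progress Sig i)))
      | .fwd r s st => Sum.inr (true, r, s, st)
      | .bwd r s st => Sum.inr (false, r, s, st))
    (fun a b h => by cases a <;> cases b <;> simp_all)

namespace Sweeper

/-- The state of the multi-tape machine. -/
def sim {M : MultiTM Sig} : Sweeper M → M.Q
  | ready q _ _ => q
  | fwd r _ _ => r.1
  | bwd r _ _ => r.1

/-- The head of tape `i` is met and moves against the direction of the sweep. -/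
def Against (mv : Fin k → Move) (s : Bool) (st : ∀ i, Progress Sig i) (x : Track Sig)
    (i : Fin k) : Prop :=
  st i = .todo ∧ x.2 i = true ∧ (mv i).shift = -sgn s

/-- The new progress of a tape in a forward step. -/
def advance {i : Fin k} (a : TapeSym Sig i) (m : Move) (x : TapeSym Sig i) (b : Bool) :
    Progress Sig i → Progress Sig i
  | .todo => if b then if m.shift = 0 then .done a else .ahead else .todo
  | .ahead => .done x
  | p => p

/-- The symbol written in a forward step. -/
def advanceSym {i : Fin k} (a : TapeSym Sig i) (x : TapeSym Sig i) (b : Bool) :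
    Progress Sig i → TapeSym Sig i
  | .todo => if b then a else x
  | _ => x

/-- The marker written in a forward step. -/
def advanceMark {i : Fin k} (m : Move) (b : Bool) : Progress Sig i → Bool
  | .todo => b && decide (m.shift = 0)
  | .ahead => true
  | _ => b

/-- The new progress of a tape in a backward step. -/
def settle {i : Fin k} (x : TapeSym Sig i) : Progress Sig i → Progress Sig i
  | .behind => .done x
  | p => p

/-- The marker written in a backward step. -/
def settleMark {i : Fin k} (b : Bool) : Progress Sig i → Bool
  | .behind => true
  | _ => b

variable {M : MultiTM Sig}

open Classical in
/-- The forward step. -/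
noncomputable def fwdStep (r : M.Q × (∀ i, TapeSym Sig i) × (Fin k → Move)) (s : Bool)
    (st : ∀ i, Progress Sig i) (x : Track Sig) : Sweeper M × Track Sig × Move :=
  if ∃ i, Against r.2.2 s st x i then
    (.bwd r s fun i => if Against r.2.2 s st x i then .behind else st i,
      (fun i => if Against r.2.2 s st x i then r.2.1 i else x.1 i,
        fun i => if Against r.2.2 s st x i then false else x.2 i),
      dirMove (!s))
  else
    let st' : ∀ i, Progress Sig i := fun i => advance (r.2.1 i) (r.2.2 i) (x.1 i) (x.2 i) (st i)
    let w : Track Sig := (fun i => advanceSym (r.2.1 i) (x.1 i) (x.2 i) (st i),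
      fun i => advanceMark (r.2.2 i) (x.2 i) (st i))
    if ∀ i, ∃ b, st' i = .done b then (.ready r.1 (fun i => (st' i).sym) (!s), w, .N)
    else (.fwd r s st', w, dirMove s)

/-- The transition function of the sweeping machine. -/
noncomputable def δ : Sweeper M → Track Sig → Option (Sweeper M × Track Sig × Move)
  | .ready q a s, x => (M.δ q a).map fun r => fwdStep r s (fun _ => .todo) x
  | .fwd r s st, x => some (fwdStep r s st x)
  | .bwd r s st, x => some (.fwd r s fun i => settle (x.1 i) (st i),
      (x.1, fun i => settleMark (x.2 i) (st i)), dirMove s)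

/-- The tracks of tape `i` during a sweep that simulates the instruction `r` in the configuration
`c`; the front of the sweep is at `f`. -/
def TrackInv (c : M.Config) (r : M.Q × (∀ i, TapeSym Sig i) × (Fin k → Move)) (s : Bool)
    (T : ℤ → Track Sig) (f : ℤ) (i : Fin k) : Progress Sig i → Prop
  | .todo => (∀ z, (T z).1 i = c.tape i z ∧ (T z).2 i = decide (z = c.head i)) ∧
      0 ≤ sgn s * (c.head i - f)
  | .ahead => (∀ z, (T z).1 i = (c.apply r).tape i z ∧ (T z).2 i = false) ∧
      (c.apply r).head i = f ∧ f = c.head i + sgn s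
  | .behind => (∀ z, (T z).1 i = (c.apply r).tape i z ∧ (T z).2 i = false) ∧
      (c.apply r).head i = f - sgn s
  | .done a => (∀ z, (T z).1 i = (c.apply r).tape i z ∧
      (T z).2 i = decide (z = (c.apply r).head i)) ∧ sgn s * ((c.apply r).head i - f) ≤ 0 ∧
      a = (c.apply r).scan i

/-! ### Correctness and cost of a sweep -/

variable {c : M.Config} {r : M.Q × (∀ i, TapeSym Sig i) × (Fin k → Move)} {s : Bool}
  {T : ℤ → Track Sig} {f : ℤ} {st : ∀ i, Progress Sig i}

/-- The marker seen at the front is the old head, so `f = c.head i`. After the write only the new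
marker, one cell back, is missing. -/
theorem TrackInv.against (i : Fin k) (h : TrackInv c r s T f i (st i))
    (ha : Against r.2.2 s st (T f) i) {w : Track Sig} (hw : w.1 i = r.2.1 i)
    (hw' : w.2 i = false) : TrackInv c r s (Function.update T f w) f i .behind := by
  obtain ⟨h0, h1, h2⟩ := ha
  rw [h0] at h
  obtain ⟨h, hf⟩ := h
  have hfc : f = c.head i := by
    have := (h f).2
    rw [h1] at this
    simpa using this.symm
  subst hfc
  refine ⟨fun z => ?_, ?_⟩
  · by_cases hz : z = c.head i
    · subst hz
      simp [hw, hw', MultiTM.Config.apply]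
    · simp [hz, MultiTM.Config.apply, h]
  · simp [MultiTM.Config.apply, h2]; ring

/-- The invariant involves only the two tracks of tape `i`; thus the tapes can be treated separately
although they share each written symbol. -/
theorem TrackInv.update_of_eq (i : Fin k) {p : Progress Sig i} (h : TrackInv c r s T f i p)
    {z : ℤ} {w : Track Sig} (hw : w.1 i = (T z).1 i) (hw' : w.2 i = (T z).2 i) :
    TrackInv c r s (Function.update T z w) f i p := by
  have key : ∀ y, ((Function.update T z w) y).1 i = (T y).1 i ∧
      ((Function.update T z w) y).2 i = (T y).2 i := by
    intro y
    by_cases hy : y = z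
    · subst hy; simp [hw, hw']
    · simp [hy]
  cases p <;> simpa [TrackInv, key] using h

theorem TrackInv.settle (i : Fin k) {p : Progress Sig i} (h : TrackInv c r s T f i p)
    {w : Track Sig} (hw : w.1 i = (T (f - sgn s)).1 i)
    (hw' : w.2 i = settleMark ((T (f - sgn s)).2 i) p) :
    TrackInv c r s (Function.update T (f - sgn s) w) f i (settle ((T (f - sgn s)).1 i) p) := by
  cases p with
  | behind =>
    obtain ⟨h, hf⟩ := h
    refine ⟨fun z => ?_, ?_, ?_⟩
    · rw [hf]
      by_cases hz : z = f - sgn s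
      · subst hz
        simp [hw, hw', settleMark, h]
      · simp [hz, h]
    · rw [hf]; cases s <;> simp [sgn]
    · rw [MultiTM.Config.scan, hf, (h _).1]
  | _ => exact h.update_of_eq i hw hw'

theorem move_cases (m : Move) (s : Bool) :
    m.shift = 0 ∨ m.shift = sgn s ∨ m.shift = -sgn s := by
  cases m <;> cases s <;> simp [Move.shift, sgn]

/-- The first conjunct compares with the old front `f`, not with `f + sgn s`: the last step of a
sweep does not move, so the sweep ends at `f`. -/
theorem TrackInv.advance (i : Fin k) (h : TrackInv c r s T f i (st i))
    (ha : ¬Against r.2.2 s st (T f) i) (hb : st i ≠ .behind) {w : Track Sig}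
    (hw : w.1 i = advanceSym (r.2.1 i) ((T f).1 i) ((T f).2 i) (st i))
    (hw' : w.2 i = advanceMark (r.2.2 i) ((T f).2 i) (st i)) :
    (∀ b, Sweeper.advance (r.2.1 i) (r.2.2 i) ((T f).1 i) ((T f).2 i) (st i) = .done b →
      sgn s * ((c.apply r).head i - f) ≤ 0) ∧
    Sweeper.advance (r.2.1 i) (r.2.2 i) ((T f).1 i) ((T f).2 i) (st i) ≠ .behind ∧
    TrackInv c r s (Function.update T f w) (f + sgn s) i
      (Sweeper.advance (r.2.1 i) (r.2.2 i) ((T f).1 i) ((T f).2 i) (st i)) := by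
  rcases hst : st i with _ | _ | _ | a <;> rw [hst] at h hw hw' hb
  · obtain ⟨h, hf⟩ := h
    by_cases hm : f = c.head i
    · have hT : (T f).2 i = true := (h f).2.trans (by simp [hm])
      have hs : (r.2.2 i).shift = 0 ∨ (r.2.2 i).shift = sgn s := by
        rcases move_cases (r.2.2 i) s with h | h | h
        · exact Or.inl h
        · exact Or.inr h
        · exact absurd ⟨hst, hT, h⟩ ha
      by_cases h0 : (r.2.2 i).shift = 0
      · simp only [hT, Sweeper.advance, advanceSym, advanceMark, h0] at hw hw' ⊢
        simp only [if_true] at hw hw' ⊢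
        have hH : (c.apply r).head i = c.head i := by simp [MultiTM.Config.apply, h0]
        refine ⟨fun b _ => by rw [hH, hm]; simp, by simp, fun z => ?_, ?_, ?_⟩
        · rw [hH]
          by_cases hz : z = f
          · subst hz
            simp [hw, hw', MultiTM.Config.apply, ← hm]
          · have hz' : z ≠ c.head i := hm ▸ hz
            simp [hz, hz', h, MultiTM.Config.apply]
        · rw [hH, hm]; cases s <;> simp [sgn]
        · rw [MultiTM.Config.scan, hH]; simp [MultiTM.Config.apply]
      · have h1 : (r.2.2 i).shift = sgn s := hs.resolve_left h0
        simp only [hT, Sweeper.advance, advanceSym, advanceMark, h0] at hw hw' ⊢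
        simp only [if_true, if_false] at hw hw' ⊢
        refine ⟨by simp, by simp, fun z => ?_, ?_, ?_⟩
        · by_cases hz : z = f
          · subst hz
            simp [hw, hw', MultiTM.Config.apply, ← hm]
          · have hz' : z ≠ c.head i := hm ▸ hz
            simp [hz, hz', h, MultiTM.Config.apply]
        · simp [MultiTM.Config.apply, h1, hm]
        · rw [hm]
    · have hT : (T f).2 i = false := by simp [(h f).2, hm]
      simp only [hT, Sweeper.advance, advanceSym, advanceMark] at hw hw' ⊢
      refine ⟨by simp, by simp, ?_⟩
      refine TrackInv.update_of_eq i ?_ (by simpa using hw) (by simpa [hT] using hw')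
      refine ⟨h, ?_⟩
      -- An unmet head that is not at the front lies strictly ahead of it, so the front may pass to
      -- the next cell.
      cases s <;> simp [sgn] at hf ⊢ <;> omega
  · obtain ⟨h, hH, hf⟩ := h
    simp only [Sweeper.advance, advanceSym, advanceMark] at hw hw' ⊢
    refine ⟨fun b _ => by rw [hH]; simp, by simp, fun z => ?_, ?_, ?_⟩
    · rw [hH]
      by_cases hz : z = f
      · subst hz; simp [hw, hw', h]
      · simp [hz, h]
    · rw [hH]; cases s <;> simp [sgn]
    · rw [MultiTM.Config.scan, hH, (h f).1]
  · exact absurd rfl hb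
  · obtain ⟨h, hH, ha⟩ := h
    simp only [Sweeper.advance, advanceSym, advanceMark] at hw hw' ⊢
    refine ⟨fun b _ => hH, by simp, TrackInv.update_of_eq i ?_ hw hw'⟩
    refine ⟨h, ?_, ha⟩
    cases s <;> simp [sgn] at hH ⊢ <;> omega

open Classical in
/-- The number of heads that have not been met. -/
noncomputable def todoCount (st : ∀ i, Progress Sig i) : ℕ :=
  (Finset.univ.filter fun i => st i = .todo).card

theorem todoCount_advance_le (x : Track Sig) :
    todoCount (fun i => advance (r.2.1 i) (r.2.2 i) (x.1 i) (x.2 i) (st i)) ≤ todoCount st := by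
  classical
  refine Finset.card_le_card fun i => ?_
  simp only [Finset.mem_filter, Finset.mem_univ, true_and]
  cases st i <;> simp [advance]

open Classical in
-- A detour serves at least one unmet head, and a served head never becomes unmet again. So a sweep
-- has at most `k` detours.
theorem todoCount_against_lt (x : Track Sig) (y : ∀ i, TapeSym Sig i)
    (h : ∃ i, Against r.2.2 s st x i) :
    todoCount (fun i => settle (y i) (if Against r.2.2 s st x i then .behind else st i)) <
      todoCount st := by
  refine Finset.card_lt_card ?_
  rw [Finset.ssubset_iff_of_subset]
  · obtain ⟨i, hi⟩ := h
    exact ⟨i, by simpa using hi.1, by simp only [Finset.mem_filter, if_pos hi]; simp [settle]⟩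
  · intro i
    simp only [Finset.mem_filter, Finset.mem_univ, true_and]
    split_ifs
    · simp [settle]
    · cases st i <;> simp [settle]

/-- The configuration of a machine that has just finished the sweep. -/
def Finished (c : M.Config) (s : Bool) (p : ℤ) : Conf (Sweeper M) (Track Sig) :=
  ⟨.ready c.state c.scan (!s), c.encode, p⟩

/-- The potential `B + 1 - sgn s * f + 2 * todoCount st` pays for the steps: an advance brings the
front one cell closer to `B + 1`, and a two-step detour returns to the same front with fewer unmet
heads. The extra 1 in `m + 1` is the last, motionless step. -/
theorem steps_of_fwd (B : ℤ) (hB : ∀ i, sgn s * c.head i ≤ B) (m : ℕ) :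
    ∀ (f : ℤ) (st : ∀ i, Progress Sig i) (T : ℤ → Track Sig),
      (∀ i, TrackInv c r s T f i (st i)) → (∀ i, st i ≠ .behind) → sgn s * f ≤ B + 1 →
      B + 1 - sgn s * f + 2 * todoCount st ≤ m →
      ∃ n p, 0 < n ∧ n ≤ m + 1 ∧
        Conf.Steps Sweeper.δ n ⟨.fwd r s st, T, f⟩ (Finished (c.apply r) s p) ∧
        sgn s * p ≤ B + 1 ∧ ∀ i, sgn s * ((c.apply r).head i - p) ≤ 0 := by
  classical
  induction m using Nat.strong_induction_on with
  | _ m ih =>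
    intro f st T hT hb hf hm
    by_cases hA : ∃ i, Against r.2.2 s st (T f) i
    · set w : Track Sig := (fun i => if Against r.2.2 s st (T f) i then r.2.1 i else (T f).1 i,
        fun i => if Against r.2.2 s st (T f) i then false else (T f).2 i) with hw
      set st1 : ∀ i, Progress Sig i :=
        fun i => if Against r.2.2 s st (T f) i then .behind else st i with hst1
      set T1 := Function.update T f w with hT1
      have step1 : Conf.step Sweeper.δ ⟨.fwd r s st, T, f⟩ = some ⟨.bwd r s st1, T1, f - sgn s⟩ := by
        rw [Conf.step_eq (q := .bwd r s st1) (w := w) (m := dirMove (!s))]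
        · simp [hT1, sub_eq_add_neg]
        · simp only [δ, fwdStep, if_pos hA]; rfl
      have inv1 : ∀ i, TrackInv c r s T1 f i (st1 i) := by
        intro i
        by_cases hi : Against r.2.2 s st (T f) i
        · simp only [hst1, if_pos hi]
          exact (hT i).against i hi (by simp [hw, hi]) (by simp [hw, hi])
        · simp only [hst1, if_neg hi]
          exact (hT i).update_of_eq i (by simp [hw, hi]) (by simp [hw, hi])
      set x := T1 (f - sgn s) with hx
      set w2 : Track Sig := (x.1, fun i => settleMark (x.2 i) (st1 i)) with hw2
      set st2 : ∀ i, Progress Sig i := fun i => settle (x.1 i) (st1 i) with hst2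
      set T2 := Function.update T1 (f - sgn s) w2 with hT2
      have step2 : Conf.step Sweeper.δ ⟨.bwd r s st1, T1, f - sgn s⟩ = some ⟨.fwd r s st2, T2, f⟩ := by
        rw [Conf.step_eq (q := .fwd r s st2) (w := w2) (m := dirMove s)]
        · simp [hT2]
        · simp only [δ, hst2, hw2, hx]
      have inv2 : ∀ i, TrackInv c r s T2 f i (st2 i) := fun i =>
        (inv1 i).settle i (by simp [hw2, hx]) (by simp [hw2, hx])
      have hlt : todoCount st2 < todoCount st := todoCount_against_lt (T f) x.1 hA
      have hb2 : ∀ i, st2 i ≠ .behind := by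
        intro i
        simp only [hst2]
        cases st1 i <;> simp [settle]
      obtain ⟨n, p, hn0, hn, hsteps, hp⟩ := ih (m - 2) (by omega) f st2 T2 inv2 hb2 hf (by omega)
      exact ⟨n + 2, p, by omega, by omega, ⟨_, step1, _, step2, hsteps⟩, hp⟩
    · set w : Track Sig := (fun i => advanceSym (r.2.1 i) ((T f).1 i) ((T f).2 i) (st i),
        fun i => advanceMark (r.2.2 i) ((T f).2 i) (st i)) with hw
      set st1 : ∀ i, Progress Sig i :=
        fun i => advance (r.2.1 i) (r.2.2 i) ((T f).1 i) ((T f).2 i) (st i) with hst1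
      set T1 := Function.update T f w with hT1
      have key := fun i => (hT i).advance i (fun h => hA ⟨i, h⟩) (hb i) (w := w) rfl rfl
      by_cases hD : ∀ i, ∃ b, st1 i = .done b
      · refine ⟨1, f, by omega, by omega, ⟨_, ?_, rfl⟩, hf, fun i => ?_⟩
        · have e1 : (c.apply r).encode = T1 := by
            funext z
            have : ∀ i, (T1 z).1 i = (c.apply r).tape i z ∧
                (T1 z).2 i = decide (z = (c.apply r).head i) := by
              intro i
              obtain ⟨b, hbi⟩ := hD i
              have := (key i).2.2
              simp only [hst1] at hbi
              rw [hbi] at this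
              exact this.1 z
            exact Prod.ext (funext fun i => (this i).1.symm) (funext fun i => (this i).2.symm)
          have e2 : (c.apply r).scan = fun i => (st1 i).sym := by
            funext i
            obtain ⟨b, hbi⟩ := hD i
            have := (key i).2.2
            rw [hbi]
            simp only [hst1] at hbi
            rw [hbi] at this
            exact this.2.2.symm
          rw [Conf.step_eq (q := .ready r.1 (fun i => (st1 i).sym) (!s)) (w := w) (m := .N)]
          · simp only [Finished, e1, e2, Move.shift, add_zero]
            rfl
          · simp only [δ, fwdStep, if_neg hA]
            rw [if_pos hD]
        · obtain ⟨b, hbi⟩ := hD i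
          exact (key i).1 b hbi
      · have step1 : Conf.step Sweeper.δ ⟨.fwd r s st, T, f⟩ =
            some ⟨.fwd r s st1, T1, f + sgn s⟩ := by
          rw [Conf.step_eq (q := .fwd r s st1) (w := w) (m := dirMove s)]
          · simp [hT1]
          · simp only [δ, fwdStep, if_neg hA]
            rw [if_neg hD]
        have hs2 : sgn s * sgn s = 1 := by cases s <;> rfl
        -- The sweep continues only for an unfinished tape. Its old head is then at or beyond the
        -- new front, or exactly one cell behind it; hence the front passes `B` by at most one.
        have hf1 : sgn s * (f + sgn s) ≤ B + 1 := by
          push Not at hD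
          obtain ⟨i, hi⟩ := hD
          have inv := (key i).2.2
          have nb := (key i).2.1
          change TrackInv c r s T1 (f + sgn s) i (st1 i) at inv
          change st1 i ≠ _ at nb
          have hBi := hB i
          rcases hsi : st1 i with _ | _ | _ | a
          · rw [hsi] at inv
            have := inv.2
            rw [mul_sub] at this
            linarith
          · rw [hsi] at inv
            rw [inv.2.2, mul_add, hs2]
            linarith
          · exact absurd hsi nb
          · exact absurd hsi (hi a)
        have hle : todoCount st1 ≤ todoCount st := todoCount_advance_le (T f)
        have hexp : sgn s * (f + sgn s) = sgn s * f + 1 := by rw [mul_add, hs2]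
        obtain ⟨n, p, hn0, hn, hsteps, hp⟩ := ih (m - 1) (by omega) (f + sgn s) st1 T1
          (fun i => (key i).2.2) (fun i => (key i).2.1) hf1 (by omega)
        exact ⟨n + 1, p, by omega, by omega, ⟨_, step1, hsteps⟩, hp⟩

theorem step_ready_none {c : M.Config} (h : M.step c = none) (s : Bool) (p : ℤ) :
    Conf.step Sweeper.δ ⟨.ready c.state c.scan s, c.encode, p⟩ = none := by
  rw [MultiTM.step_eq, Option.map_eq_none_iff] at h
  simp [Conf.step, δ, h]

/-- One sweep simulates one step. -/
theorem steps_ready {c c' : M.Config} (h : M.step c = some c') {s : Bool} {p : ℤ} {w : ℕ}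
    (hc : ∀ i, 0 ≤ sgn s * (c.head i - p) ∧ sgn s * (c.head i - p) ≤ w) :
    ∃ n p', 0 < n ∧ n ≤ w + 2 * k + 2 ∧
      Conf.Steps Sweeper.δ n ⟨.ready c.state c.scan s, c.encode, p⟩
        ⟨.ready c'.state c'.scan (!s), c'.encode, p'⟩ ∧
      ∀ i, 0 ≤ sgn (!s) * (c'.head i - p') ∧ sgn (!s) * (c'.head i - p') ≤ (w + 2 : ℕ) := by
  rw [MultiTM.step_eq, Option.map_eq_some_iff] at h
  obtain ⟨r, hr, rfl⟩ := h
  have hcount : todoCount (fun i : Fin k => (.todo : Progress Sig i)) = k := by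
    simp [todoCount]
  -- The farthest old head gives `B = sgn s * p + w`; with all `k` heads unmet the potential is `w +
  -- 1 + 2 * k`.
  obtain ⟨n, p', hn0, hn, hsteps, hp, hH⟩ := steps_of_fwd (r := r) (s := s) (c := c)
    (sgn s * p + w) (fun i => by have := (hc i).2; rw [mul_sub] at this; linarith)
    (w + 1 + 2 * k) p (fun _ => .todo) c.encode
    (fun i => ⟨fun z => ⟨rfl, rfl⟩, (hc i).1⟩) (by simp) (by omega)
    (by rw [hcount]; push_cast; linarith)
  refine ⟨n, p', hn0, by omega, ?_, fun i => ?_⟩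
  -- The transition from `ready` is already the first forward step, so starting a sweep costs
  -- nothing.
  · obtain ⟨m, rfl⟩ : ∃ m, n = m + 1 := ⟨n - 1, by omega⟩
    obtain ⟨d, hd, hs⟩ := hsteps
    refine ⟨d, ?_, hs⟩
    rw [← hd]
    simp [Conf.step, δ, hr]
  · have h1 := (hc i).1
    have h2 := hH i
    have h3 : (c.apply r).head i = c.head i + (r.2.2 i).shift := rfl
    have h4 : (r.2.2 i).shift ≤ 1 ∧ -1 ≤ (r.2.2 i).shift := by
      cases r.2.2 i <;> simp [Move.shift]
    rw [h3] at h2 ⊢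
    push_cast
    -- A new head is at most one cell before `p`, and the sweep ends at most one cell beyond `p + w
    -- * sgn s`: together `w + 2`.
    cases s <;> simp [sgn] at h1 h2 hp ⊢ <;> omega

end Sweeper

/-! ### Simulating the first steps from memory -/

/-- The cell `z` belongs to the window of `n + 1` cells that begins at `p` and extends in the
direction `s`. -/
def InWindow (p : ℤ) (s : Bool) (n : ℕ) (z : ℤ) : Prop :=
  0 ≤ sgn s * (z - p) ∧ sgn s * (z - p) ≤ n

namespace MultiTM

variable {M : MultiTM Sig}

/-- The configuration with the symbol in cell `p` of the first tape replaced. -/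
def Config.learn (c : M.Config) (p : ℤ) (a : TapeSym Sig 0) : M.Config where
  state := c.state
  tape := Function.update c.tape 0 (Function.update (c.tape 0) p a)
  head := c.head

/-- The displacement by which a tape with the head on cell `h` is brought into a window. -/
def recenterShift (b : ℤ) (s : Bool) (n : ℕ) (h : ℤ) : ℤ :=
  if h = b - sgn s then sgn s else if h = b + (n + 1) * sgn s then -sgn s else 0

/-- The configuration with the tapes translated so that the heads are in the window. -/
def Config.recenter (c : M.Config) (b : ℤ) (s : Bool) (n : ℕ) : M.Config where
  state := c.state
  tape := fun i z => c.tape i (z - recenterShift b s n (c.head i))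
  head := fun i => c.head i + recenterShift b s n (c.head i)

theorem Config.shifted_recenter (c : M.Config) (b : ℤ) (s : Bool) (n : ℕ) :
    c.Shifted (c.recenter b s n) :=
  ⟨rfl, fun i => ⟨recenterShift b s n (c.head i), rfl, fun z => by simp [Config.recenter]⟩⟩

/-- The configurations agree, except possibly on the cells of the first tape outside `P`. -/
def Config.Agree (P : ℤ → Prop) (m c : M.Config) : Prop :=
  m.state = c.state ∧ m.head = c.head ∧ (∀ i, i ≠ 0 → m.tape i = c.tape i) ∧
    ∀ z, P z → m.tape 0 z = c.tape 0 z

theorem Config.Agree.mono {P P' : ℤ → Prop} {m c : M.Config} (h : m.Agree P c)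
    (hP : ∀ z, P' z → P z) : m.Agree P' c :=
  ⟨h.1, h.2.1, h.2.2.1, fun z hz => h.2.2.2 z (hP z hz)⟩

theorem Config.Agree.scan_eq {P : ℤ → Prop} {m c : M.Config} (h : m.Agree P c)
    (hP : P (c.head 0)) : m.scan = c.scan := by
  funext i
  rw [Config.scan, Config.scan, h.2.1]
  by_cases hi : i = 0
  · subst hi; exact h.2.2.2 _ hP
  · rw [h.2.2.1 i hi]

theorem Config.Agree.apply {P : ℤ → Prop} {m c : M.Config} (h : m.Agree P c)
    (r : M.Q × (∀ i, TapeSym Sig i) × (Fin k → Move)) : (m.apply r).Agree P (c.apply r) := by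
  obtain ⟨h1, h2, h3, h4⟩ := h
  refine ⟨rfl, by simp [Config.apply, h2], fun i hi => by simp [Config.apply, h2, h3 i hi],
    fun z hz => ?_⟩
  simp only [Config.apply, h2, Function.update_apply, h4 z hz]

/-- The memory knows the first tape only on `P`, so this tape must stay in place. -/
theorem Config.Agree.recenter {P : ℤ → Prop} {m c : M.Config} (h : m.Agree P c) {b : ℤ} {s : Bool}
    {n : ℕ} (h0 : recenterShift b s n (c.head 0) = 0) :
    (m.recenter b s n).Agree P (c.recenter b s n) := by
  obtain ⟨h1, h2, h3, h4⟩ := h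
  refine ⟨h1, by simp [Config.recenter, h2], fun i hi => by simp [Config.recenter, h2, h3 i hi],
    fun z hz => ?_⟩
  simp [Config.recenter, h2, h0, h4 z hz]

theorem Config.Agree.learn {P P' : ℤ → Prop} {m c : M.Config} (h : m.Agree P c) {p : ℤ}
    (hP : ∀ z, P' z → P z ∨ z = p) : (m.learn p (c.tape 0 p)).Agree P' c := by
  obtain ⟨h1, h2, h3, h4⟩ := h
  refine ⟨h1, h2, fun i hi => by simp [Config.learn, hi, h3 i hi], fun z hz => ?_⟩
  by_cases hzp : z = p
  · subst hzp; simp [Config.learn]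
  · simp [Config.learn, hzp, h4 z ((hP z hz).resolve_right hzp)]

theorem Config.Agree.encode_eq {P : ℤ → Prop} {m c : M.Config} (h : m.Agree P c) {z : ℤ}
    (hz : P z) : m.encode z = c.encode z := by
  obtain ⟨h1, h2, h3, h4⟩ := h
  refine Prod.ext (funext fun i => ?_) (by simp [Config.encode, h2])
  by_cases hi : i = 0
  · subst hi; exact h4 z hz
  · simp [Config.encode, h3 i hi]

end MultiTM

/-- The states of the machine that works from memory. In `ready m p s n rem` the head is on cell
`p`, the tape shows the configuration that agrees with `m` on the window of `n + 1` cells from `p`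
in the direction `s`, and `rem` steps remain. In `write m e p s n rem j` the cell `p` and the
next `j` cells in the direction `s` have to be overwritten according to `m`, except that cell `e` of
the first tape is kept and stored. -/
inductive Recorder (M : MultiTM Sig) : Type
  | ready (m : M.Config) (p : ℤ) (s : Bool) (n rem : ℕ)
  | write (m : M.Config) (e p : ℤ) (s : Bool) (n rem j : ℕ)

namespace Recorder

variable {M : MultiTM Sig}

/-- The state of the multi-tape machine. -/
def sim : Recorder M → M.Q
  | ready m _ _ _ _ => m.state
  | write m _ _ _ _ _ _ => m.state

/-- The state after the last cell of the window has been written. -/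
def finish (m : M.Config) (p : ℤ) (s : Bool) (n : ℕ) : ℕ → Recorder M ⊕ Sweeper M
  | 0 => .inr (.ready m.state m.scan s)
  | rem + 1 => .inl (.ready m p s n (rem + 1))

/-- The memory after cell `p` has been read. -/
def look (m : M.Config) (e p : ℤ) (x : Track Sig) : M.Config :=
  if p = e then m.learn p (x.1 0) else m

/-- Overwriting one cell. -/
def writeStep (m : M.Config) (e p : ℤ) (s : Bool) (n rem : ℕ) (x : Track Sig) :
    ℕ → (Recorder M ⊕ Sweeper M) × Track Sig × Move
  | 0 => (finish (look m e p x) p (!s) n rem, (look m e p x).encode p, .N)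
  | j + 1 => (.inl (.write (look m e p x) e (p + sgn s) s n rem j), (look m e p x).encode p,
      dirMove s)

/-- The beginning of the simulation of a step to the configuration `m`. -/
def begin (m : M.Config) (p : ℤ) (s : Bool) (n rem : ℕ) (x : Track Sig) :
    (Recorder M ⊕ Sweeper M) × Track Sig × Move :=
  if m.head 0 = p - sgn s then
    if n = 0 then
      writeStep (m.recenter p (!s) 1) (p + sgn (!s)) p (!s) 1 rem x 1
    else
      (.inl (.write (m.recenter (p - sgn s) s (n + 1)) (p - sgn s) (p - sgn s) s (n + 1) rem
        (n + 1)), x, dirMove (!s))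
  else
    writeStep (m.recenter p s (n + 1)) (p + (n + 1) * sgn s) p s (n + 1) rem x (n + 1)

/-- The transition function. -/
def δ : Recorder M → Track Sig → Option ((Recorder M ⊕ Sweeper M) × Track Sig × Move)
  | ready _ _ _ _ 0, _ => none
  | ready m p s n (rem + 1), x => (M.step (m.learn p (x.1 0))).map fun c => begin c p s n rem x
  | write m e p s n rem j, x => some (writeStep m e p s n rem x j)

/-- A measure that decreases in every transition. -/
def rank : Recorder M → ℕ ×ₗ ℕ
  | ready _ _ _ _ rem => toLex (rem, 0)
  | write _ _ _ _ _ rem j => toLex (rem, j + 1)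

end Recorder

/-- The transition function that works from memory at first and then sweeps. -/
noncomputable def simδ {M : MultiTM Sig} : Recorder M ⊕ Sweeper M → Track Sig →
    Option ((Recorder M ⊕ Sweeper M) × Track Sig × Move)
  | .inl q, x => q.δ x
  | .inr q, x => (q.δ x).map fun r => (.inr r.1, r.2)

/-! ### Correctness and cost of rewriting the window -/

namespace Recorder

variable {M : MultiTM Sig}

/-- Invariant: outside the `j + 1` remaining cells the tape already shows `d`. The memory knows `d`
on the window, except possibly the first-tape symbol in `e`, which stands unchanged on the tape
until the head gets there. -/
theorem steps_write {d : M.Config} {b e : ℤ} {s : Bool} {n rem : ℕ} (j : ℕ) :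
    ∀ (m : M.Config) (p : ℤ) (T : ℤ → Track Sig), InWindow b s n p → sgn s * (p - b) + j = n →
      (∀ z, ¬InWindow p s j z → T z = d.encode z) → (InWindow p s j e → (T e).1 0 = d.tape 0 e) →
      m.Agree (fun z => InWindow b s n z ∧ (z = e → ¬InWindow p s j e)) d →
      ∃ m' q, m'.Agree (InWindow b s n) d ∧
        (simδ (.inl (.write m e p s n rem j)) (T p) = some (writeStep m e p s n rem (T p) j)) ∧
        q = b + n * sgn s ∧
        Conf.Steps simδ (j + 1) ⟨.inl (.write m e p s n rem j), T, p⟩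
          ⟨finish m' q (!s) n rem, d.encode, q⟩ := by
  induction j with
  | zero =>
    intro m p T hp hj hT he hm
    have hout : ∀ z, z ≠ p → ¬InWindow p s 0 z := by
      intro z hz
      unfold InWindow
      cases s <;> simp [sgn] <;> omega
    have hag : (look m e p (T p)).Agree (InWindow b s n) d := by
      unfold look
      split_ifs with hpe
      · subst hpe
        rw [he (by unfold InWindow; simp)]
        exact hm.learn fun z hz => or_iff_not_imp_right.2 fun h => ⟨hz, fun h' => absurd h' h⟩
      · exact hm.mono fun z hz => ⟨hz, fun h => hout _ (Ne.symm hpe)⟩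
    refine ⟨look m e p (T p), p, hag, rfl, ?_, ?_⟩
    · cases s <;> simp [sgn] at hj ⊢ <;> omega
    · refine ⟨_, Conf.step_eq (q := finish (look m e p (T p)) p (!s) n rem)
        (w := (look m e p (T p)).encode p) (m := .N) rfl, ?_⟩
      have : d.encode = Function.update T p ((look m e p (T p)).encode p) := by
        funext z
        by_cases hz : z = p
        · subst hz
          rw [Function.update_self, hag.encode_eq hp]
        · rw [Function.update_of_ne hz, hT z (hout z hz)]
      simp only [Conf.Steps, this, Move.shift, add_zero]
  | succ j ih =>
    intro m p T hp hj hT he hm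
    push_cast at hj
    have hwin : ∀ z, z ≠ p → (InWindow (p + sgn s) s j z ↔ InWindow p s (j + 1) z) := by
      intro z hz
      unfold InWindow
      cases s <;> simp [sgn] <;> omega
    have hnot : ¬InWindow (p + sgn s) s j p := by
      unfold InWindow
      cases s <;> simp [sgn]
    have hself : InWindow p s (j + 1) p := by unfold InWindow; simp; positivity
    have hag : (look m e p (T p)).Agree
        (fun z => InWindow b s n z ∧ (z = e → ¬InWindow (p + sgn s) s j e)) d := by
      unfold look
      split_ifs with hpe
      · subst hpe
        rw [he hself]
        exact hm.learn fun z hz => or_iff_not_imp_right.2 fun h => ⟨hz.1, fun h' => absurd h' h⟩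
      · exact hm.mono fun z hz => ⟨hz.1, fun h h' => hz.2 h ((hwin e (Ne.symm hpe)).2 h')⟩
    have hpp : (look m e p (T p)).encode p = d.encode p := hag.encode_eq ⟨hp, fun h => h ▸ hnot⟩
    obtain ⟨m', q, h1, -, h2, h3⟩ := ih (look m e p (T p)) (p + sgn s)
      (Function.update T p ((look m e p (T p)).encode p))
      (by unfold InWindow at hp ⊢; cases s <;> simp [sgn] at hp hj ⊢ <;> omega)
      (by cases s <;> simp [sgn] at hj ⊢ <;> omega)
      (fun z hz => by
        by_cases hzp : z = p
        · subst hzp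
          rw [Function.update_self, hpp]
        · rw [Function.update_of_ne hzp]
          exact hT z fun h => hz ((hwin z hzp).2 h))
      (fun h => by
        have hep : e ≠ p := fun h' => hnot (h' ▸ h)
        rw [Function.update_of_ne hep]
        exact he ((hwin e hep).1 h))
      hag
    refine ⟨m', q, h1, rfl, h2, _, Conf.step_eq (q := .inl (.write (look m e p (T p)) e (p + sgn s)
      s n rem j)) (w := (look m e p (T p)).encode p) (m := dirMove s) rfl, ?_⟩
    simpa using h3

/-- A moved head leaves the old window by at most one cell. If it misses the new window, it does so
at the end that did not grow; translating by one cell towards the grown end uses the spare cell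
there, so the old window still fits. -/
theorem recenterShift_window {p b e : ℤ} {s s' : Bool} {n : ℕ} {h m : ℤ}
    (hgeo : (e = b + (n + 1) * sgn s' ∧ b = p ∧ (s' = s ∨ n = 0)) ∨
      (e = b ∧ b = p - sgn s ∧ s' = s))
    (hh : InWindow p s n h) (hm : m ≤ 1 ∧ -1 ≤ m) :
    InWindow b s' (n + 1) (h + m + MultiTM.recenterShift b s' (n + 1) (h + m)) ∧
      ∀ z, InWindow p s n (z - MultiTM.recenterShift b s' (n + 1) (h + m)) →
        InWindow b s' (n + 1) z := by
  obtain ⟨hm1, hm2⟩ := hm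
  unfold InWindow at *
  unfold MultiTM.recenterShift
  push_cast
  rcases hgeo with ⟨rfl, rfl, rfl | rfl⟩ | ⟨rfl, rfl, rfl⟩
  · cases s' <;> simp [sgn] at hh ⊢ <;> split_ifs <;>
      refine ⟨by omega, fun z h1 h2 => by omega⟩
  · cases s' <;> cases s <;> simp [sgn] at hh ⊢ <;> split_ifs <;>
      refine ⟨by omega, fun z h1 h2 => by omega⟩
  · cases s' <;> simp [sgn] at hh ⊢ <;> split_ifs <;>
      refine ⟨by omega, fun z h1 h2 => by omega⟩

/-- The multi-tape machine does a step that can be simulated by writing the window from `b`. -/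
theorem steps_begin {c c' m' : M.Config} {p b e : ℤ} {s s' : Bool} {n rem : ℕ}
    (hblank : ∀ i, i ≠ 0 → ∀ z, ¬InWindow p s n z → c.tape i z = .blank)
    (hhead : ∀ i, InWindow p s n (c.head i)) (hstep : M.step c = some c')
    (hag : m'.Agree (InWindow p s n) c')
    (hgeo : (e = b + (n + 1) * sgn s' ∧ b = p ∧ (s' = s ∨ n = 0)) ∨
      (e = b ∧ b = p - sgn s ∧ s' = s))
    (h0 : InWindow b s' (n + 1) (c'.head 0)) :
    ∃ m'' q, m''.Agree (InWindow b s' (n + 1)) (c'.recenter b s' (n + 1)) ∧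
      q = b + (n + 1 : ℕ) * sgn s' ∧
      simδ (.inl (.write (m'.recenter b s' (n + 1)) e b s' (n + 1) rem (n + 1))) (c.encode b) =
        some (writeStep (m'.recenter b s' (n + 1)) e b s' (n + 1) rem (c.encode b) (n + 1)) ∧
      Conf.Steps simδ (n + 2)
        ⟨.inl (.write (m'.recenter b s' (n + 1)) e b s' (n + 1) rem (n + 1)), c.encode, b⟩
        ⟨finish m'' q (!s') (n + 1) rem, (c'.recenter b s' (n + 1)).encode, q⟩ ∧
      (∀ i, InWindow b s' (n + 1) ((c'.recenter b s' (n + 1)).head i)) ∧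
      ∀ i, i ≠ 0 → ∀ z, ¬InWindow b s' (n + 1) z →
        (c'.recenter b s' (n + 1)).tape i z = .blank := by
  rw [MultiTM.step_eq, Option.map_eq_some_iff] at hstep
  obtain ⟨r, hr, rfl⟩ := hstep
  have hmv : ∀ i, (r.2.2 i).shift ≤ 1 ∧ -1 ≤ (r.2.2 i).shift := by
    intro i
    cases r.2.2 i <;> simp [Move.shift]
  -- The window grew where the first head needs it, so the first tape is not translated.
  have hs0 : MultiTM.recenterShift b s' (n + 1) ((c.apply r).head 0) = 0 := by
    unfold MultiTM.recenterShift
    unfold InWindow at h0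
    rw [if_neg, if_neg]
    all_goals push_cast at h0 ⊢; cases s' <;> simp [sgn] at h0 ⊢ <;> omega
  -- `e` is the one new cell of the window. No head scanned it, so its first-tape symbol is
  -- unaffected by the step.
  have he : ¬InWindow p s n e := by
    unfold InWindow
    rcases hgeo with ⟨rfl, rfl, rfl | rfl⟩ | ⟨rfl, rfl, rfl⟩
    · cases s' <;> simp [sgn]
    · cases s' <;> cases s <;> simp [sgn]
    · cases s' <;> simp [sgn]
  have hew : ∀ z, InWindow b s' (n + 1) z → z ≠ e → InWindow p s n z := by
    intro z
    unfold InWindow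
    rcases hgeo with ⟨rfl, rfl, rfl | rfl⟩ | ⟨rfl, rfl, rfl⟩
    · cases s' <;> simp [sgn] <;> omega
    · cases s' <;> cases s <;> simp [sgn] <;> omega
    · cases s' <;> simp [sgn] <;> omega
  have hew' : InWindow b s' (n + 1) e := by
    unfold InWindow
    rcases hgeo with ⟨rfl, rfl, rfl | rfl⟩ | ⟨rfl, rfl, rfl⟩
    · cases s' <;> simp [sgn] <;> omega
    · cases s' <;> simp [sgn]
    · cases s' <;> simp [sgn] <;> omega
  have hwin : ∀ z, InWindow p s n z → InWindow b s' (n + 1) z := by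
    intro z
    unfold InWindow
    rcases hgeo with ⟨rfl, rfl, rfl | rfl⟩ | ⟨rfl, rfl, rfl⟩
    · cases s' <;> simp [sgn] <;> omega
    · cases s' <;> cases s <;> simp [sgn] <;> omega
    · cases s' <;> simp [sgn] <;> omega
  have hrec := fun i => recenterShift_window hgeo (hhead i) (hmv i)
  have htape : ∀ i z, ¬InWindow b s' (n + 1) z → ((c.apply r).recenter b s' (n + 1)).tape i z =
      c.tape i (z - MultiTM.recenterShift b s' (n + 1) ((c.apply r).head i)) := by
    intro i z hz
    refine Function.update_of_ne (fun h => hz ((hrec i).2 z ?_)) _ _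
    have h' : z - MultiTM.recenterShift b s' (n + 1) (c.head i + (r.2.2 i).shift) = c.head i := h
    rw [h']
    exact hhead i
  have hblank' : ∀ i, i ≠ 0 → ∀ z, ¬InWindow b s' (n + 1) z →
      ((c.apply r).recenter b s' (n + 1)).tape i z = .blank := by
    intro i hi z hz
    rw [htape i z hz]
    exact hblank i hi _ fun h => hz ((hrec i).2 z h)
  have htape0 : ((c.apply r).recenter b s' (n + 1)).tape 0 = (c.apply r).tape 0 := by
    funext z
    simp [MultiTM.Config.recenter, hs0]
  obtain ⟨m'', q, h1, h2, h3, h4⟩ := steps_write (d := (c.apply r).recenter b s' (n + 1)) (b := b)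
    (e := e) (s := s') (n := n + 1) (rem := rem) (n + 1) (m'.recenter b s' (n + 1)) b c.encode
    (by unfold InWindow; simp; positivity) (by simp)
    (fun z hz => by
      refine Prod.ext (funext fun i => ?_) (funext fun i => ?_)
      · by_cases hi : i = 0
        · subst hi
          refine Eq.trans ?_ (congrFun htape0 z).symm
          exact (Function.update_of_ne (fun h : z = c.head 0 => hz (hwin z (h ▸ hhead 0))) _ _).symm
        · exact (hblank i hi z fun h => hz (hwin z h)).trans (hblank' i hi z hz).symm
      · refine decide_eq_decide.2 ⟨fun h => absurd (hwin z (h ▸ hhead i)) hz,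
          fun h => absurd (h ▸ (hrec i).1) hz⟩)
    (fun _ => by
      rw [htape0]
      exact (Function.update_of_ne (fun h : e = c.head 0 => he (h ▸ hhead 0)) _ _).symm)
    ((hag.recenter hs0).mono fun z hz => hew z hz.1 fun h => hz.2 h hew')
  exact ⟨m'', q, h1, h3, h2, h4, fun i => (hrec i).1, hblank'⟩

/-- The configurations in which the machine shows the configuration `c` of the multi-tape machine
and knows its window of `n + 1` cells. -/
def ReadyAt (c : M.Config) (n rem : ℕ) (d : Conf (Recorder M ⊕ Sweeper M) (Track Sig)) : Prop :=
  ∃ m p s, d = ⟨.inl (.ready m p s n rem), c.encode, p⟩ ∧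
    (∀ i, InWindow p s n (c.head i)) ∧
    (∀ i, i ≠ 0 → ∀ z, ¬InWindow p s n z → c.tape i z = .blank) ∧
    (m.learn p (c.tape 0 p)).Agree (InWindow p s n) c ∧ m.state = c.state

end Recorder

/-- The configurations in which the machine shows the configuration `c` of the multi-tape machine
and sweeps next, while all heads are within `w + 1` cells. -/
def Sweeper.ReadyAt {M : MultiTM Sig} (c : M.Config) (w : ℕ)
    (d : Conf (Recorder M ⊕ Sweeper M) (Track Sig)) : Prop :=
  ∃ s p, d = ⟨.inr (.ready c.state c.scan s), c.encode, p⟩ ∧ ∀ i, InWindow p s w (c.head i)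

namespace Recorder

variable {M : MultiTM Sig}

/-- Writing ends at the opposite end of the window, which is then described from there in the
reversed direction. -/
theorem finish_readyAt {m c : M.Config} {b q : ℤ} {s : Bool} {n rem : ℕ}
    (hag : m.Agree (InWindow b s n) c) (hq : q = b + n * sgn s)
    (hhead : ∀ i, InWindow b s n (c.head i))
    (hblank : ∀ i, i ≠ 0 → ∀ z, ¬InWindow b s n z → c.tape i z = .blank) :
    (rem = 0 ∧ Sweeper.ReadyAt c n ⟨finish m q (!s) n rem, c.encode, q⟩) ∨
      (0 < rem ∧ ReadyAt c n rem ⟨finish m q (!s) n rem, c.encode, q⟩) := by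
  have hwin : ∀ z, InWindow q (!s) n z ↔ InWindow b s n z := by
    intro z
    unfold InWindow
    cases s <;> simp [sgn] at hq ⊢ <;> omega
  cases rem with
  | zero =>
    refine Or.inl ⟨rfl, !s, q, ?_, fun i => (hwin _).2 (hhead i)⟩
    simp only [finish, hag.scan_eq (hhead 0), hag.1]
  | succ rem =>
    exact Or.inr ⟨by omega, m, q, !s, rfl, fun i => (hwin _).2 (hhead i),
      fun i hi z hz => hblank i hi z fun h => hz ((hwin z).2 h),
      hag.learn fun z hz => Or.inl ((hwin z).1 hz), hag.1⟩

theorem ReadyAt.step_none {c : M.Config} {n rem : ℕ}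
    {d : Conf (Recorder M ⊕ Sweeper M) (Track Sig)} (hd : ReadyAt c n (rem + 1) d)
    (h : M.step c = none) : d.step simδ = none := by
  obtain ⟨m, p, s, rfl, hhead, hblank, hag, -⟩ := hd
  rw [MultiTM.step_eq, Option.map_eq_none_iff] at h
  have h1 : (m.learn p (c.tape 0 p)).scan = c.scan := hag.scan_eq (hhead 0)
  simp only [Conf.step, simδ, δ, MultiTM.step_eq, Option.map_map, Option.map_eq_none_iff]
  change M.δ (m.learn p (c.tape 0 p)).state (m.learn p (c.tape 0 p)).scan = none
  rw [h1, hag.1, h]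

/-- The window grows at the near end if the first head leaves it there, otherwise at the far end.
Writing takes `n + 2` steps; growth at the near end needs one more to step back, which fits into `2
* (n + 1)` only for `n ≥ 1`. A one-cell window has no preferred direction, so for `n = 0` the
direction is reversed instead. -/
theorem ReadyAt.steps {c c' : M.Config} {n rem : ℕ}
    {d : Conf (Recorder M ⊕ Sweeper M) (Track Sig)} (hd : ReadyAt c n (rem + 1) d)
    (h : M.step c = some c') :
    ∃ c'' d' l, c'.Shifted c'' ∧ 0 < l ∧ l ≤ 2 * (n + 1) ∧ Conf.Steps simδ l d d' ∧
      ((rem = 0 ∧ Sweeper.ReadyAt c'' (n + 1) d') ∨ (0 < rem ∧ ReadyAt c'' (n + 1) rem d')) := by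
  obtain ⟨m, p, s, rfl, hhead, hblank, hag, -⟩ := hd
  have h' := h
  rw [MultiTM.step_eq, Option.map_eq_some_iff] at h'
  obtain ⟨r, hr, hrc⟩ := h'
  set m' := (m.learn p (c.tape 0 p)).apply r with hm'
  have hag' : m'.Agree (InWindow p s n) c' := hrc ▸ hag.apply r
  have hstep : M.step (m.learn p (c.tape 0 p)) = some m' := by
    rw [MultiTM.step_eq, hag.1, hag.scan_eq (hhead 0), hr]; rfl
  have hδ : simδ (.inl (.ready m p s n (rem + 1))) (c.encode p) =
      some (begin m' p s n rem (c.encode p)) := by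
    simp only [simδ, δ]
    rw [show (c.encode p).1 0 = c.tape 0 p from rfl, hstep]; rfl
  have hm0 : m'.head 0 = c'.head 0 := by rw [hag'.2.1]
  have hc0 : c'.head 0 = c.head 0 + (r.2.2 0).shift := by rw [← hrc]; rfl
  have hmv : (r.2.2 0).shift ≤ 1 ∧ -1 ≤ (r.2.2 0).shift := by
    cases r.2.2 0 <;> simp [Move.shift]
  have hh0 := hhead 0
  by_cases hnear : c'.head 0 = p - sgn s
  · by_cases hn : n = 0
    · subst hn
      obtain ⟨m'', q, h1, h2, h3, h4, h5, h6⟩ := steps_begin (rem := rem) (b := p)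
        (e := p + sgn (!s)) (s' := !s) hblank hhead h hag' (Or.inl ⟨by simp, rfl, Or.inr rfl⟩)
        (by rw [hnear]; unfold InWindow; cases s <;> simp [sgn])
      refine ⟨_, _, 2, MultiTM.Config.shifted_recenter _ _ _ _, by omega, by omega, ?_,
        finish_readyAt h1 h2 h5 h6⟩
      -- The transition from `ready` itself writes the first cell, so it replaces the first step of
      -- `h4`.
      obtain ⟨y, hy, hs⟩ := h4
      refine ⟨y, ?_, hs⟩
      rw [← hy]
      simp only [Conf.step, hδ, h3, begin, hm0, if_pos hnear, if_true, zero_add]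
    · obtain ⟨m'', q, h1, h2, h3, h4, h5, h6⟩ := steps_begin (rem := rem) (b := p - sgn s)
        (e := p - sgn s) (s' := s) hblank hhead h hag' (Or.inr ⟨rfl, rfl, rfl⟩)
        (by rw [hnear]; unfold InWindow; simp; positivity)
      refine ⟨_, _, n + 2 + 1, MultiTM.Config.shifted_recenter _ _ _ _, by omega, by omega, ?_,
        finish_readyAt h1 h2 h5 h6⟩
      refine ⟨_, ?_, h4⟩
      simp only [Conf.step, hδ, begin, hm0, if_pos hnear, if_neg hn, Option.map_some,
        dirMove_shift, sgn_not, Function.update_eq_self, ← sub_eq_add_neg]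
  · obtain ⟨m'', q, h1, h2, h3, h4, h5, h6⟩ := steps_begin (rem := rem) (b := p)
      (e := p + (n + 1) * sgn s) (s' := s) hblank hhead h hag' (Or.inl ⟨rfl, rfl, Or.inl rfl⟩)
      (by
        unfold InWindow at hh0 ⊢
        push_cast
        cases s <;> simp [sgn] at hh0 hnear ⊢ <;> omega)
    refine ⟨_, _, n + 2, MultiTM.Config.shifted_recenter _ _ _ _, by omega, by omega, ?_,
      finish_readyAt h1 h2 h5 h6⟩
    obtain ⟨y, hy, hs⟩ := h4
    refine ⟨y, ?_, hs⟩
    rw [← hy]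
    simp only [Conf.step, hδ, h3, begin, hm0, if_neg hnear]

end Recorder

/-! ### The single-tape machine -/

/-! ### Finiteness of the reachable memory states -/

namespace Recorder

variable {M : MultiTM Sig}

/-- A transition is possible between two states. -/
def Succ (q q' : Recorder M) : Prop := ∃ x w m, q.δ x = some (.inl q', w, m)

theorem writeStep_rank {m : M.Config} {e p : ℤ} {s : Bool} {n rem j : ℕ} {x w : Track Sig}
    {mv : Move} {q' : Recorder M} (h : writeStep m e p s n rem x j = (.inl q', w, mv)) :
    q'.rank < (write m e p s n rem j).rank := by
  cases j with
  | zero =>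
    cases rem <;> simp only [writeStep, finish, Prod.mk.injEq, reduceCtorEq, false_and] at h
    obtain ⟨h, -⟩ := h
    cases h
    simp [rank, Prod.Lex.toLex_lt_toLex]
  | succ j =>
    simp only [writeStep, Prod.mk.injEq] at h
    obtain ⟨h, -⟩ := h
    cases h
    simp [rank, Prod.Lex.toLex_lt_toLex]

theorem Succ.rank_lt {q q' : Recorder M} (h : Succ q q') : q'.rank < q.rank := by
  obtain ⟨x, w, mv, h⟩ := h
  cases q with
  | ready m p s n rem =>
    cases rem with
    | zero => simp [δ] at h
    | succ rem =>
      simp only [δ, Option.map_eq_some_iff] at h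
      obtain ⟨c, -, h⟩ := h
      have key : ∀ (m₁ m₂ : M.Config) (e b : ℤ) (s : Bool) (n j : ℕ),
          (write m₁ e b s n rem j).rank < (ready m₂ p s n (rem + 1)).rank := by
        intros
        simp [rank, Prod.Lex.toLex_lt_toLex]
      unfold begin at h
      split_ifs at h
      · exact (writeStep_rank h).trans (key _ m _ _ _ _ _)
      · simp only [Prod.mk.injEq] at h
        obtain ⟨h, -⟩ := h
        cases h
        exact key _ m _ _ _ _ _
      · exact (writeStep_rank h).trans (key _ m _ _ _ _ _)
  | write m e p s n rem j =>
    simp only [δ, Option.some.injEq] at h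
    exact writeStep_rank h

theorem finite_succ [∀ i, Finite (Sig i)] (q : Recorder M) : {q' | Succ q q'}.Finite := by
  have h : (Set.range fun x => (q.δ x).map Prod.fst).Finite := Set.finite_range _
  refine (h.preimage (f := fun q' : Recorder M => some (Sum.inl q')) ?_).subset ?_
  · intro a _ b _ hab
    simpa using hab
  · rintro q' ⟨x, w, m, hx⟩
    exact ⟨x, by simp [hx]⟩

/-- The states carry integers and whole tapes, but each has finitely many successors, as the
alphabet is finite, and all of them have smaller rank. Well-founded induction on the rank applies.
-/
theorem finite_reachable [∀ i, Finite (Sig i)] (q : Recorder M) :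
    {q' | Relation.ReflTransGen Succ q q'}.Finite := by
  induction q using (InvImage.wf rank wellFounded_lt).induction with
  | _ q ih =>
    refine ((Set.finite_singleton q).union ((finite_succ q).biUnion fun q' hq' =>
      ih q' (Succ.rank_lt hq'))).subset fun q' hq' => ?_
    rcases Relation.ReflTransGen.cases_head hq' with rfl | ⟨d, hd, h⟩
    · exact Or.inl rfl
    · exact Or.inr (Set.mem_biUnion (x := d) hd h)

/-- The initial state. -/
def init (M : MultiTM Sig) : Recorder M := .ready (M.start []) 0 true 0 (2 * k)

end Recorder

/-! ### The machine on reachable states -/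

section Machine

variable {M : MultiTM Sig}

/-- The states of the single-tape machine. -/
def Reachable (q : Recorder M ⊕ Sweeper M) : Prop :=
  ∀ q', q = .inl q' → Relation.ReflTransGen Recorder.Succ (Recorder.init M) q'

/-- The final states of the single-tape machine. -/
def IsFinal : Recorder M ⊕ Sweeper M → Prop
  | .inl (.ready m _ _ _ _) => m.state ∈ M.F
  | .inr (.ready q _ _) => q ∈ M.F
  | _ => False

theorem Reachable.simδ {q : Recorder M ⊕ Sweeper M} (hq : Reachable q) (x : Track Sig) :
    ∀ r ∈ simδ q x, Reachable r.1 := by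
  rintro ⟨r, w, m⟩ hr q' rfl
  rw [Option.mem_def] at hr
  cases q with
  | inl q => exact (hq q rfl).tail ⟨x, w, m, hr⟩
  | inr q =>
    simp only [GrossoneTM.simδ, Option.map_eq_some_iff] at hr
    obtain ⟨a, -, ha⟩ := hr
    simp at ha

/-- The single-tape machine that simulates `M`. -/
noncomputable def simTM [∀ i, Finite (Sig i)] (M : MultiTM Sig) :
    SingleTM (Track Sig) (trackBlank Sig) where
  Q := {q : Recorder M ⊕ Sweeper M // Reachable q}
  finite_Q := by
    have h : {q : Recorder M ⊕ Sweeper M | Reachable q}.Finite := by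
      refine (((Recorder.finite_reachable (Recorder.init M)).image Sum.inl).union
        (Set.finite_range Sum.inr)).subset ?_
      rintro (q | q) hq
      · exact Or.inl ⟨q, hq q rfl, rfl⟩
      · exact Or.inr ⟨q, rfl⟩
    exact h.to_subtype
  Sig := {trackBlank Sig}ᶜ
  blank_notMem := by simp
  q₀ := ⟨.inl (Recorder.init M), fun q' h => by cases h; exact .refl⟩
  F := {q | IsFinal q.1}
  δ q x := Option.pmap (fun r hr => (⟨r.1, hr⟩, r.2)) (simδ q.1 x) (q.2.simδ x)
  δ_final := by
    rintro ⟨(q | q), hq⟩ hF x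
    · rcases q with ⟨m, p, s, n, rem⟩ | _
      · have hF : m.state ∈ M.F := hF
        cases rem with
        | zero => simp [simδ, Recorder.δ]
        | succ rem => simp [simδ, Recorder.δ, MultiTM.step, MultiTM.Config.learn, M.δ_final _ hF]
      · exact hF.elim
    · rcases q with ⟨q, a, s⟩ | _ | _
      · have hF : q ∈ M.F := hF
        simp [simδ, Sweeper.δ, M.δ_final _ hF]
      · exact hF.elim
      · exact hF.elim

/-- The state of `M` that a state of the single-tape machine shows. -/
noncomputable def simState [∀ i, Finite (Sig i)] (M : MultiTM Sig) (q : (simTM M).Q) : M.Q :=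
  Sum.elim Recorder.sim Sweeper.sim q.1

variable [∀ i, Finite (Sig i)]

/-- The configuration without the restriction on the states. -/
def toConf (c : (simTM M).Config) : Conf (Recorder M ⊕ Sweeper M) (Track Sig) :=
  ⟨c.state.1, c.tape, c.head⟩

theorem map_toConf_step (c : (simTM M).Config) :
    ((simTM M).step c).map toConf = (toConf c).step simδ := by
  have h : ((simTM M).δ c.state (c.tape c.head)).map (fun r => (r.1.1, r.2)) =
      simδ c.state.1 (c.tape c.head) := by
    simp [simTM, Option.map_pmap]
  simp only [SingleTM.step, Conf.step, toConf, ← h, Option.map_map]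
  rfl

theorem exists_run_of_steps {T : ℤ → Track Sig} {n : ℕ} :
    ∀ {m : ℕ} {c : (simTM M).Config} {d : Conf (Recorder M ⊕ Sweeper M) (Track Sig)},
      (simTM M).run T m = some c → Conf.Steps simδ n (toConf c) d →
      ∃ c', (simTM M).run T (m + n) = some c' ∧ toConf c' = d := by
  induction n with
  | zero => exact fun hm h => ⟨_, hm, h⟩
  | succ n ih =>
    rintro m c d hm ⟨y, hy, h⟩
    rw [← map_toConf_step, Option.map_eq_some_iff] at hy
    obtain ⟨c1, hc1, rfl⟩ := hy
    have hm1 : (simTM M).run T (m + 1) = some c1 := by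
      rw [SingleTM.run, hm]; exact hc1
    obtain ⟨c', h1, h2⟩ := ih hm1 h
    exact ⟨c', by rw [← h1]; congr 1; omega, h2⟩

end Machine

theorem Sweeper.steps_simδ {M : MultiTM Sig} {n : ℕ} :
    ∀ {c d : Conf (Sweeper M) (Track Sig)}, Conf.Steps Sweeper.δ n c d →
      Conf.Steps simδ n ⟨.inr c.state, c.tape, c.head⟩ ⟨.inr d.state, d.tape, d.head⟩ := by
  induction n with
  | zero => rintro c d h; cases h; rfl
  | succ n ih =>
    rintro c d ⟨y, hy, h⟩
    refine ⟨_, ?_, ih h⟩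
    simp only [Conf.step, Option.map_eq_some_iff] at hy
    obtain ⟨r, hr, rfl⟩ := hy
    simp [Conf.step, simδ, hr]

/-! ### Joining the two phases and adding the costs -/

section Simulation

variable {M : MultiTM Sig}

/-- The configurations that show the configuration `c` which `M` has reached in `t` steps. -/
def ShowsAt (t : ℕ) (c : M.Config) (d : Conf (Recorder M ⊕ Sweeper M) (Track Sig)) : Prop :=
  (∃ rem, t + (rem + 1) = 2 * k ∧ Recorder.ReadyAt c t (rem + 1) d) ∨
    ∃ w, w + 2 * k = 2 * t ∧ Sweeper.ReadyAt c w d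

theorem ShowsAt.step_none {t : ℕ} {c : M.Config}
    {d : Conf (Recorder M ⊕ Sweeper M) (Track Sig)} (hd : ShowsAt t c d) (h : M.step c = none) :
    d.step simδ = none := by
  rcases hd with ⟨rem, -, hd⟩ | ⟨w, -, s, p, rfl, -⟩
  · exact hd.step_none h
  · have := Sweeper.step_ready_none h s p
    simp only [Conf.step, Option.map_eq_none_iff] at this
    simp [Conf.step, simδ, this]

/-- While sweeping, `w + 2 * k = 2 * t`, so the cost `w + 2 * k + 2` is `2 * (t + 1)`. -/
theorem ShowsAt.steps {t : ℕ} {c c' : M.Config}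
    {d : Conf (Recorder M ⊕ Sweeper M) (Track Sig)} (hd : ShowsAt t c d)
    (h : M.step c = some c') :
    ∃ c'' d' l, c'.Shifted c'' ∧ 0 < l ∧ l ≤ 2 * (t + 1) ∧ Conf.Steps simδ l d d' ∧
      ShowsAt (t + 1) c'' d' := by
  rcases hd with ⟨rem, ht, hd⟩ | ⟨w, hw, s, p, rfl, hd⟩
  · obtain ⟨c'', d', l, h1, h2, h3, h4, h5⟩ := hd.steps h
    refine ⟨c'', d', l, h1, h2, h3, h4, ?_⟩
    rcases h5 with ⟨rfl, h5⟩ | ⟨hr, h5⟩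
    -- The memory phase ends with `t + 1 = 2 * k`, where `w = t + 1` satisfies `w + 2 * k = 2 * (t +
    -- 1)`.
    · exact Or.inr ⟨t + 1, by omega, h5⟩
    · obtain ⟨rem, rfl⟩ : ∃ r, rem = r + 1 := ⟨rem - 1, by omega⟩
      exact Or.inl ⟨rem, by omega, h5⟩
  · obtain ⟨n, p', h1, h2, h3, h4⟩ := Sweeper.steps_ready h hd
    exact ⟨c', _, n, .refl _, h1, by omega, Sweeper.steps_simδ h3,
      Or.inr ⟨w + 2, by omega, !s, p', rfl, h4⟩⟩

theorem encode_start (x : List (Sig 0)) : (M.start x).encode = trackStart Sig x := rfl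

theorem showsAt_start (x : List (Sig 0)) :
    ShowsAt 0 (M.start x) ⟨.inl (Recorder.init M), trackStart Sig x, 0⟩ := by
  have hk : k ≠ 0 := NeZero.ne k
  have hwin : ∀ z, InWindow 0 true 0 z ↔ z = 0 := by
    intro z
    unfold InWindow
    simp only [sgn, Nat.cast_zero]
    omega
  refine Or.inl ⟨2 * k - 1, by omega, M.start [], 0, true, ?_, fun i => (hwin _).2 rfl, ?_, ?_, rfl⟩
  · rw [encode_start, Recorder.init, Nat.sub_add_cancel (show 1 ≤ 2 * k by omega)]
  · intro i hi z hz
    rw [hwin] at hz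
    simp [MultiTM.start, startTape, hi, hz]
  -- The initial memory ignores the input; the only cell of the window is cell `0`, which `ready`
  -- reads before it acts.
  · have hag : (M.start []).Agree (fun _ => False) (M.start x) := by
      refine ⟨rfl, rfl, fun i hi => ?_, by simp⟩
      funext z
      simp [MultiTM.start, startTape, hi]
    exact hag.learn fun z hz => Or.inr ((hwin z).1 hz)

/-- The upper bound is `t ^ 2 + t + 2 * (t + 1) = (t + 1) ^ 2 + (t + 1)`. The lower bound `t ≤ s`
serves the converse half of equivalence. -/
theorem exists_showsAt {x : List (Sig 0)} {t : ℕ} :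
    ∀ {c : M.Config}, M.run x t = some c →
      ∃ c' d s, c.Shifted c' ∧ t ≤ s ∧ s ≤ t ^ 2 + t ∧
        Conf.Steps simδ s ⟨.inl (Recorder.init M), trackStart Sig x, 0⟩ d ∧ ShowsAt t c' d := by
  induction t with
  | zero =>
    intro c hc
    cases hc
    exact ⟨_, _, 0, .refl _, le_rfl, by simp, rfl, showsAt_start x⟩
  | succ t ih =>
    intro c hc
    rw [MultiTM.run, Option.bind_eq_some_iff] at hc
    obtain ⟨b, hb, hc⟩ := hc
    obtain ⟨b', d, s, h1, h2, h3, h4, h5⟩ := ih hb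
    rw [MultiTM.step_eq, Option.map_eq_some_iff] at hc
    obtain ⟨r, hr, rfl⟩ := hc
    have hstep : M.step b' = some (b'.apply r) := by
      rw [MultiTM.step_eq, h1.1, h1.scan_eq, hr]; rfl
    obtain ⟨c'', d', l, g1, g2, g3, g4, g5⟩ := h5.steps hstep
    exact ⟨c'', d', s + l, (h1.apply r).trans g1, by omega, by nlinarith, h4.trans g4, g5⟩

theorem ShowsAt.state {t : ℕ} {c : M.Config} {d : Conf (Recorder M ⊕ Sweeper M) (Track Sig)}
    (hd : ShowsAt t c d) :
    Sum.elim Recorder.sim Sweeper.sim d.state = c.state ∧ (IsFinal d.state ↔ c.Final) ∧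
      d.tape = c.encode := by
  rcases hd with ⟨rem, -, m, p, s, rfl, -, -, -, hm⟩ | ⟨w, -, s, p, rfl, -⟩
  · exact ⟨hm, by simp [IsFinal, MultiTM.Config.Final, hm], rfl⟩
  · exact ⟨rfl, Iff.rfl, rfl⟩

variable [∀ i, Finite (Sig i)]

/-- The first `t` steps of `M` are simulated in at most `t ^ 2 + t` steps. -/
theorem exists_run_represents {x : List (Sig 0)} {t : ℕ} {c : M.Config}
    (h : M.run x t = some c) :
    ∃ s c', t ≤ s ∧ s ≤ t ^ 2 + t ∧ (simTM M).run (trackStart Sig x) s = some c' ∧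
      Represents (simState M) c' c ∧ (M.step c = none → (simTM M).step c' = none) := by
  obtain ⟨b, d, s, h1, h2, h3, h4, h5⟩ := exists_showsAt h
  obtain ⟨c', hc', rfl⟩ := exists_run_of_steps (M := M) (T := trackStart Sig x) (m := 0) rfl h4
  rw [Nat.zero_add] at hc'
  obtain ⟨g1, g2, g3⟩ := h5.state
  refine ⟨s, c', h2, h3, hc', h1.represents g1 g2 g3, fun hn => ?_⟩
  have hb : M.step b = none := by
    rw [MultiTM.step_eq, Option.map_eq_none_iff] at hn ⊢
    rw [h1.1, h1.scan_eq, hn]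
  simpa [← map_toConf_step] using h5.step_none hb

end Simulation

/-! ### Halting and equivalence -/

theorem SingleTM.run_eq_none_of_le {Γ : Type} {b : Γ} (M : SingleTM Γ b) {T : ℤ → Γ} {m n : ℕ}
    (h : M.run T m = none) (hmn : m ≤ n) : M.run T n = none := by
  induction n, hmn using Nat.le_induction with
  | base => exact h
  | succ n _ ih => rw [SingleTM.run, ih]; rfl

theorem SingleTM.le_of_step_eq_none {Γ : Type} {b : Γ} (M : SingleTM Γ b) {T : ℤ → Γ} {m n : ℕ}
    {c d : M.Config} (hc : M.run T m = some c) (hs : M.step c = none) (hd : M.run T n = some d) :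
    n ≤ m := by
  by_contra hlt
  have h : M.run T (m + 1) = none := by rw [SingleTM.run, hc]; exact hs
  rw [M.run_eq_none_of_le h (by omega)] at hd
  cases hd

theorem SingleTM.step_eq_none_of_final {Γ : Type} {b : Γ} (M : SingleTM Γ b) {c : M.Config}
    (hc : c.Final) : M.step c = none := by
  simp [SingleTM.step, M.δ_final _ hc]

theorem equivalent_simTM [∀ i, Finite (Sig i)] (M : MultiTM Sig) :
    Equivalent M (simTM M) (simState M) := by
  intro x
  refine ⟨fun t c hc hF => ?_, fun s c' hc' hF => ?_⟩
  · obtain ⟨s, c', -, -, h1, h2, -⟩ := exists_run_represents hc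
    exact ⟨s, c', h1, h2.2.1.2 hF, h2⟩
  · have hs := (simTM M).step_eq_none_of_final hF
    -- Simulating `s + 1` steps would take at least `s + 1` steps, but the single-tape machine stops
    -- after `s`.
    have hex : ∃ n, M.run x n = none := by
      refine ⟨s + 1, Option.eq_none_iff_forall_ne_some.2 fun c hc => ?_⟩
      obtain ⟨s', d, h1, -, h2, -⟩ := exists_run_represents hc
      have := (simTM M).le_of_step_eq_none hc' hs h2
      omega
    classical
    obtain ⟨t, ht⟩ : ∃ t, Nat.find hex = t + 1 := by
      refine Nat.exists_eq_succ_of_ne_zero fun h0 => ?_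
      have := Nat.find_spec hex
      rw [h0] at this
      cases this
    obtain ⟨c, hc⟩ := Option.ne_none_iff_exists'.1 (Nat.find_min hex (m := t) (by omega))
    have hn := Nat.find_spec hex
    rw [ht, MultiTM.run, hc] at hn
    obtain ⟨s', d, -, -, h2, h3, h4⟩ := exists_run_represents hc
    -- The last configuration of `M` is shown by a configuration that is stuck as well. A
    -- deterministic run has only one stuck configuration, so it is the given final one.
    have e1 := (simTM M).le_of_step_eq_none hc' hs h2
    have e2 := (simTM M).le_of_step_eq_none h2 (h4 hn) hc'
    obtain rfl : s = s' := le_antisymm e2 e1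
    obtain rfl : c' = d := Option.some_injective _ (hc'.symm.trans h2)
    exact ⟨t, c, hc, h3.2.1.1 hF, h3⟩

/-! ### Hyperfinite computations -/

open Filter

theorem sq_add_le_of_le_hsqrt {G t : Internal ℕ}
    (h : toHyperreal t ≤ 1 / 2 * (hsqrt (4 * toHyperreal G + 1) - 1)) : t ^ 2 + t ≤ G := by
  induction G using Germ.inductionOn with | _ G => ?_
  induction t using Germ.inductionOn with | _ t => ?_
  have h' : ∀ᶠ n in (hyperfilter ℕ : Filter ℕ),
      (t n : ℝ) ≤ 1 / 2 * (√(4 * (G n : ℝ) + 1) - 1) := Germ.coe_le.1 h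
  refine Germ.coe_le.2 (h'.mono fun n hn => ?_)
  have h0 : (0 : ℝ) ≤ 4 * (G n : ℝ) + 1 := by positivity
  have h1 := Real.sq_sqrt h0
  have h2 : 2 * (t n : ℝ) + 1 ≤ √(4 * (G n : ℝ) + 1) := by linarith
  have h3 : (0 : ℝ) ≤ t n := by positivity
  have h4 : (t n : ℝ) ^ 2 + t n ≤ G n := by nlinarith
  exact_mod_cast h4

theorem exists_simulates [∀ i, Finite (Sig i)] {M : MultiTM Sig} {x : Internal (List (Sig 0))}
    {t : Internal ℕ} {c : Internal M.Config} (h : M.Reaches x t c) :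
    ∃ s : Internal ℕ, Simulates M (simTM M) (simState M) x t s ∧ s ≤ t ^ 2 + t := by
  have hG := h
  induction x using Germ.inductionOn with | _ x => ?_
  induction t using Germ.inductionOn with | _ t => ?_
  induction c using Germ.inductionOn with | _ c => ?_
  have h' : ∀ᶠ n in (hyperfilter ℕ : Filter ℕ), M.run (x n) (t n) = some (c n) := Germ.coe_eq.1 h
  have key : ∀ n, ∃ s c', M.run (x n) (t n) = some (c n) →
      s ≤ t n ^ 2 + t n ∧ (simTM M).run (trackStart Sig (x n)) s = some c' ∧
        Represents (simState M) c' (c n) := by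
    intro n
    by_cases hn : M.run (x n) (t n) = some (c n)
    · obtain ⟨s, c', -, h1, h2, h3, -⟩ := exists_run_represents hn
      exact ⟨s, c', fun _ => ⟨h1, h2, h3⟩⟩
    -- Arbitrary values: these indices form a set outside the ultrafilter.
    · exact ⟨0, (simTM M).start (trackStart Sig (x n)), fun h => absurd h hn⟩
  choose s c' hs using key
  have hR : ∀ᶠ n in (hyperfilter ℕ : Filter ℕ),
      (simTM M).run (trackStart Sig (x n)) (s n) = some (c' n) := h'.mono fun n hn => (hs n hn).2.1
  have hrep : ∀ᶠ n in (hyperfilter ℕ : Filter ℕ), Represents (simState M) (c' n) (c n) :=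
    h'.mono fun n hn => (hs n hn).2.2
  refine ⟨(s : Internal ℕ), ⟨(t : Internal ℕ), (c : Internal M.Config),
    (c' : Internal (simTM M).Config), le_rfl, hG, Germ.coe_eq.2 hR, hrep, fun e he hF => ?_⟩,
    Germ.coe_le.2 (h'.mono fun n hn => (hs n hn).1)⟩
  induction e using Germ.inductionOn with | _ e => ?_
  have he' : ∀ᶠ n in (hyperfilter ℕ : Filter ℕ), M.run (x n) (t n) = some (e n) :=
    Germ.coe_eq.1 he
  have hce : ∀ᶠ n in (hyperfilter ℕ : Filter ℕ), c n = e n := by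
    filter_upwards [h', he'] with n h1 h2
    exact Option.some_injective _ (h1.symm.trans h2)
  have hF' : ∀ᶠ n in (hyperfilter ℕ : Filter ℕ), (e n).Final := hF
  refine ⟨rfl, Germ.coe_eq.2 hce, ?_⟩
  have : ∀ᶠ n in (hyperfilter ℕ : Filter ℕ), (c' n).Final := by
    filter_upwards [h', hce, hF'] with n h1 h2 h3
    exact (hs n h1).2.2.2.1.2 (h2 ▸ h3)
  exact this

end GrossoneTM

theorem theorem5 {k : ℕ} [NeZero k] (hk : 2 ≤ k) (Sig : Fin k → Type) [∀ i, Finite (Sig i)]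
    (M : GrossoneTM.MultiTM Sig) :
    Nat.card (GrossoneTM.Track Sig) =
        2 ^ k * (Nat.card (Sig 0) + 1) *
          ∏ i ∈ (Finset.univ.erase (0 : Fin k)), (Nat.card (Sig i) + 2) ∧
      ∃ (M' : GrossoneTM.SingleTM (GrossoneTM.Track Sig) (GrossoneTM.trackBlank Sig))
        (π : M'.Q → M.Q),
        (∀ (x : List (Sig 0)) (z : ℤ),
          GrossoneTM.trackStart Sig x z = GrossoneTM.trackBlank Sig ∨
            GrossoneTM.trackStart Sig x z ∈ M'.Sig) ∧
        GrossoneTM.Equivalent M M' π ∧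
        ∀ (G : GrossoneTM.Internal ℕ), GrossoneTM.IsGrossone G →
          ∀ (x : GrossoneTM.Internal (List (Sig 0))) (t : GrossoneTM.Internal ℕ)
            (c : GrossoneTM.Internal M.Config),
            M.Reaches x t c →
            GrossoneTM.toHyperreal t ≤
              1 / 2 * (GrossoneTM.hsqrt (4 * GrossoneTM.toHyperreal G + 1) - 1) →
            ∃ s : GrossoneTM.Internal ℕ,
              GrossoneTM.Simulates M M' π x t s ∧ s ≤ t ^ 2 + t ∧ t ^ 2 + t ≤ G ∧
                GrossoneTM.ObservableInSequence G s := by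
  refine ⟨GrossoneTM.card_track, GrossoneTM.simTM M, GrossoneTM.simState M,
    fun x z => or_iff_not_imp_left.2 fun h => h, GrossoneTM.equivalent_simTM M,
    fun G _ x t c hc ht => ?_⟩
  obtain ⟨s, h1, h2⟩ := GrossoneTM.exists_simulates hc
  have h3 := GrossoneTM.sq_add_le_of_le_hsqrt ht
  exact ⟨s, h1, h2, h3, h2.trans h3⟩
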